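/- Let $N\in\mathbb N$, $T>0$, and let $g:\mathbb R^N\to\mathbb R$ be bounded and continuous. For $x\in\mathbb R^N$ let $E(x)$ be the symmetric positive semidefinite $N\times N$ matrix with entries $E_{ij}(x)=e^{-|x_i-x_j|}$, and let $\sqrt{E(x)}$ be its positive semidefinite square root. For $(y_0,t_0)\in\mathbb R^N\times[0,T]$ define the value function $$v(y_0,t_0)=\inf\Big\{\tfrac12\int_{t_0}^T|\alpha(t)|^2\,dt+g(x(T))\Big\},$$ where the infimum is taken over all measurable controls $\alpha:[0,T]\to\mathbb R^N$ and all absolutely continuous solutions $x:[t_0,T]\to\mathbb R^N$ of $\dot x(t)=\sqrt{E(x(t))}\,\alpha(t)$ for a.e. $t\in(t_0,T)$, $x(t_0)=y_0$ (a control with $\int_{t_0}^T|\alpha|^2\,dt=\infty$ has cost $+\infty$). Consider the terminal value problem $$\begin{cases} u_t(x,t)+\min_{a\in\mathbb R^N}\big\{\sqrt{E(x)}\,a\cdot\nabla u(x,t)+\tfrac12|a|^2\big\}=0, & x\in\mathbb R^N,\ t\in(0,T),\\ u(x,T)=g(x), & x\in\mathbb R^N.\end{cases}\qquad(\ast)$$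 A bounded upper (respectively lower) semicontinuous function $w:\mathbb R^N\times(0,T]\to\mathbb R$ is a viscosity subsolution (respectively supersolution) of $(\ast)$ if $w(x,T)\le g(x)$ (respectively $\ge$) for all $x\in\mathbb R^N$ and, for every $\varphi\in C^1(\mathbb R^N\times(0,T))$, whenever $w-\varphi$ has a local maximum (respectively minimum) at $(y_0,t_0)\in\mathbb R^N\times(0,T)$, $$\varphi_t(y_0,t_0)+\min_{a\in\mathbb R^N}\big\{\sqrt{E(y_0)}\,a\cdot\nabla\varphi(y_0,t_0)+\tfrac12|a|^2\big\}\ \ge 0\quad(\text{respectively }\le 0).$$ A viscosity solution is a function that is both a subsolution and a supersolution. A function $w:\mathbb R^N\times(0,T]\to\mathbb R$ is a discontinuous viscosity solution if $w^*$ is a viscosity subsolution and $w_*$ is a viscosity supersolution, where $w^*(x,t)=\limsup_{(y,s)\to(x,t)}w(y,s)$ and $w_*(x,t)=\liminf_{(y,s)\to(x,t)}w(y,s)$ are the upper and lower semicontinuous envelopes of $w$ on $\mathbb R^N\times(0,T]$. **Theorem.** If $N=2$, then $v$ is continuous on $\mathbb R^2\times[0,T]$ and is a viscosity solution of $(\ast)$.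 If $N\ge3$, then $v$ is lower semicontinuous on $\mathbb R^N\times[0,T]$ and is a discontinuous viscosity solution of $(\ast)$. -/

import Mathlib

open Set Filter Topology MeasureTheory
open scoped Matrix MatrixOrder ENNReal

noncomputable section

namespace Peakon

/-- The Euclidean space `ℝ^N`. -/
abbrev Space (N : ℕ) : Type := EuclideanSpace ℝ (Fin N)

/-- The matrix `E(x)` with entries `exp (-|x_i - x_j|)`. -/
def E {N : ℕ} (x : Space N) : Matrix (Fin N) (Fin N) ℝ :=
  Matrix.of fun i j => Real.exp (-|x i - x j|)

/-- The positive semidefinite square root of `E(x)`, acting on `ℝ^N`. -/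
def sqrtE {N : ℕ} (x : Space N) : Space N →L[ℝ] Space N :=
  Matrix.toEuclideanCLM (n := Fin N) (𝕜 := ℝ) (CFC.sqrt (E x))

/-- `x` is an (absolutely continuous) solution on `[t₀, T]` of the state equation
`ẋ = √E(x) α` a.e. on `(t₀, T)`, with `x(t₀) = y₀`. -/
structure IsTrajectory {N : ℕ} (T : ℝ) (α : ℝ → Space N) (y₀ : Space N) (t₀ : ℝ)
    (x : ℝ → Space N) : Prop where
  absolutelyContinuous : AbsolutelyContinuousOnInterval x t₀ T
  hasDerivAt : ∀ᵐ t ∂(volume.restrict (Ioo t₀ T)), HasDerivAt x (sqrtE (x t) (α t)) t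
  initial : x t₀ = y₀

/-- The cost `½ ∫_{t₀}^T |α|² + g(x(T))`; it equals `+∞` if `α` is not square integrable
on `(t₀, T)`. -/
def cost {N : ℕ} (T : ℝ) (g : Space N → ℝ) (t₀ : ℝ) (α x : ℝ → Space N) : EReal :=
  (((1 / 2 : ℝ≥0∞) * ∫⁻ t in Ioo t₀ T, ‖α t‖ₑ ^ 2 : ℝ≥0∞) : EReal) + ((g (x T) : ℝ) : EReal)

/-- The infimum of the cost over all (Lebesgue) measurable controls on `[0, T]` and all solutions
of the corresponding state equation. -/
def extendedValue {N : ℕ} (T : ℝ) (g : Space N → ℝ) (p : Space N × ℝ) : EReal :=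
  ⨅ (α : ℝ → Space N) (x : ℝ → Space N)
    (_ : AEMeasurable α (volume.restrict (Icc 0 T)) ∧ IsTrajectory T α p.1 p.2 x),
    cost T g p.2 α x

/-- The value function of the Bolza problem; only its values at times in `[0, T]` matter. -/
def valueFunction {N : ℕ} (T : ℝ) (g : Space N → ℝ) (p : Space N × ℝ) : ℝ :=
  (extendedValue T g p).toReal

/-- For bounded `g` the infimum is finite, so `toReal` loses nothing. -/
theorem coe_valueFunction {N : ℕ} (T : ℝ) (g : Space N → ℝ) (hb : ∃ C : ℝ, ∀ x, |g x| ≤ C)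
    (p : Space N × ℝ) : ((valueFunction T g p : ℝ) : EReal) = extendedValue T g p := by
  obtain ⟨C, hC⟩ := hb
  have hlow : ((-C : ℝ) : EReal) ≤ extendedValue T g p := by
    refine le_iInf fun α => le_iInf fun x => le_iInf fun _ => ?_
    have h1 : ((-C : ℝ) : EReal) ≤ ((g (x T) : ℝ) : EReal) :=
      EReal.coe_le_coe_iff.2 (abs_le.1 (hC _)).1
    refine h1.trans ?_
    have h2 : (0 : EReal) ≤
        (((1 / 2 : ℝ≥0∞) * ∫⁻ t in Ioo p.2 T, ‖α t‖ₑ ^ 2 : ℝ≥0∞) : EReal) :=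
      EReal.coe_ennreal_nonneg _
    simpa [cost] using add_le_add_left h2 ((g (x T) : ℝ) : EReal)
  have hup : extendedValue T g p ≤ ((g p.1 : ℝ) : EReal) := by
    have hx : IsTrajectory T (fun _ => 0) p.1 p.2 (fun _ => p.1) := by
      refine ⟨?_, ?_, rfl⟩
      · exact (LipschitzWith.const p.1).lipschitzOnWith.absolutelyContinuousOnInterval
      · exact Eventually.of_forall fun t => by simpa using hasDerivAt_const t p.1
    have hle : extendedValue T g p ≤ cost T g p.2 (fun _ => 0) (fun _ => p.1) :=
      iInf_le_of_le (fun _ : ℝ => (0 : Space N)) (iInf_le_of_le (fun _ : ℝ => p.1)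
        (iInf_le_of_le ⟨aemeasurable_const, hx⟩ le_rfl))
    refine hle.trans ?_
    simp [cost]
  refine EReal.coe_toReal ?_ ?_
  · exact ne_top_of_le_ne_top (EReal.coe_ne_top _) hup
  · exact ne_bot_of_le_ne_bot (EReal.coe_ne_bot _) hlow

/-- `ℝ^N × (0, T]`. -/
def domain (N : ℕ) (T : ℝ) : Set (Space N × ℝ) := univ ×ˢ Ioc 0 T

/-- `min_a { √E(y) a · q + ½ |a|² }`; the minimum is attained at `a = -√E(y) q`. -/
def hamiltonian {N : ℕ} (y q : Space N) : ℝ :=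
  ⨅ a : Space N, (inner ℝ (sqrtE y a) q + 1 / 2 * ‖a‖ ^ 2)

/-- The infimum in `hamiltonian` is a minimum. -/
theorem isLeast_hamiltonian {N : ℕ} (y q : Space N) :
    IsLeast (range fun a : Space N => (inner ℝ (sqrtE y a) q + 1 / 2 * ‖a‖ ^ 2 : ℝ))
      (hamiltonian y q) := by
  have hsa : star (sqrtE y) = sqrtE y := by
    unfold sqrtE
    rw [← map_star]
    congr 1
    exact (CFC.sqrt_nonneg (E y)).isSelfAdjoint
  have hsymm : ∀ a : Space N, (inner ℝ (sqrtE y a) q : ℝ) = inner ℝ a (sqrtE y q) := by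
    intro a
    conv_rhs => rw [← hsa]
    exact (ContinuousLinearMap.adjoint_inner_right (sqrtE y) a q).symm
  have key : IsLeast (range fun a : Space N => (inner ℝ (sqrtE y a) q + 1 / 2 * ‖a‖ ^ 2 : ℝ))
      (-(1 / 2) * ‖sqrtE y q‖ ^ 2) := by
    constructor
    · refine ⟨-sqrtE y q, ?_⟩
      simp only [hsymm, inner_neg_left, real_inner_self_eq_norm_sq, norm_neg]
      ring
    · rintro _ ⟨a, rfl⟩
      simp only [hsymm]
      have := norm_add_sq_real a (sqrtE y q)
      nlinarith [sq_nonneg ‖a + sqrtE y q‖]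
  have : hamiltonian y q = -(1 / 2) * ‖sqrtE y q‖ ^ 2 := key.isGLB.ciInf_eq
  rw [this]
  exact key

/-- The left-hand side `φ_t + min_a { √E(y) a · ∇φ + ½ |a|² }` of the equation at `(y, t)`. -/
def hjb {N : ℕ} (φ : Space N × ℝ → ℝ) (y : Space N) (t : ℝ) : ℝ :=
  deriv (fun s => φ (y, s)) t + hamiltonian y (gradient (fun z => φ (z, t)) y)

/-- Bounded upper semicontinuous viscosity subsolutions on `ℝ^N × (0, T]` of the terminal value
problem with datum `g`. As `ℝ^N × (0, T)` is open, `IsLocalMax` there only sees that set. -/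
structure IsViscositySubsolution {N : ℕ} (T : ℝ) (g : Space N → ℝ) (w : Space N × ℝ → ℝ) :
    Prop where
  bounded : ∃ C : ℝ, ∀ p ∈ domain N T, |w p| ≤ C
  usc : UpperSemicontinuousOn w (domain N T)
  terminal : ∀ y, w (y, T) ≤ g y
  viscosity : ∀ φ : Space N × ℝ → ℝ, ContDiffOn ℝ 1 φ (univ ×ˢ Ioo 0 T) →
    ∀ (y₀ : Space N) (t₀ : ℝ), t₀ ∈ Ioo 0 T → IsLocalMax (fun p => w p - φ p) (y₀, t₀) →
      0 ≤ hjb φ y₀ t₀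

/-- Bounded lower semicontinuous viscosity supersolutions. -/
structure IsViscositySupersolution {N : ℕ} (T : ℝ) (g : Space N → ℝ) (w : Space N × ℝ → ℝ) :
    Prop where
  bounded : ∃ C : ℝ, ∀ p ∈ domain N T, |w p| ≤ C
  lsc : LowerSemicontinuousOn w (domain N T)
  terminal : ∀ y, g y ≤ w (y, T)
  viscosity : ∀ φ : Space N × ℝ → ℝ, ContDiffOn ℝ 1 φ (univ ×ˢ Ioo 0 T) →
    ∀ (y₀ : Space N) (t₀ : ℝ), t₀ ∈ Ioo 0 T → IsLocalMin (fun p => w p - φ p) (y₀, t₀) →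
      hjb φ y₀ t₀ ≤ 0

/-- A viscosity solution is both a sub- and a supersolution. -/
def IsViscositySolution {N : ℕ} (T : ℝ) (g : Space N → ℝ) (w : Space N × ℝ → ℝ) : Prop :=
  IsViscositySubsolution T g w ∧ IsViscositySupersolution T g w

/-- The upper semicontinuous envelope `w^*` on `ℝ^N × (0, T]`. -/
def upperEnvelope {N : ℕ} (T : ℝ) (w : Space N × ℝ → ℝ) (p : Space N × ℝ) : ℝ :=
  limsup w (𝓝[domain N T] p)

/-- The lower semicontinuous envelope `w_*` on `ℝ^N × (0, T]`. -/
def lowerEnvelope {N : ℕ} (T : ℝ) (w : Space N × ℝ → ℝ) (p : Space N × ℝ) : ℝ :=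
  liminf w (𝓝[domain N T] p)

/-- `w^*` is a viscosity subsolution and `w_*` a viscosity supersolution. Since `w_* ≤ w ≤ w^*`,
boundedness of both envelopes means boundedness of `w`, which is recorded separately because
a real-valued `limsup` or `liminf` is meaningful only for locally bounded functions. -/
structure IsDiscontinuousViscositySolution {N : ℕ} (T : ℝ) (g : Space N → ℝ)
    (w : Space N × ℝ → ℝ) : Prop where
  bounded : ∃ C : ℝ, ∀ p ∈ domain N T, |w p| ≤ C
  sub : IsViscositySubsolution T g (upperEnvelope T w)
  super : IsViscositySupersolution T g (lowerEnvelope T w)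

end Peakon

end

/-!
The argument replaces controls by a dual notion. If `ẋ = √E(x) α`, then Young's inequality gives
`p · ẋ ≤ ½ |α|² + ½ |√E(x) p|²` for every momentum `p`. A pair of a curve `x` and a function `F`
satisfying the integrated form of this inequality (`Peakon.IsAction`) involves only the quadratic
form of `E`, which is Lipschitz in `x`, whereas `√E` is merely Hölder continuous. Conversely, such a
pair yields a control of energy at most `F(T) - F(t₀)` (`Peakon.exists_isTrajectory`): at almost
every time `p · ẋ ≤ F' + ½ p · E(x) p` for all `p`, which forces `ẋ = E(x) u` for some `u`, and
`α = √E(x) u` satisfies `½ |α|² ≤ F'`. So the value function is an infimum over pairs `(x, F)`, and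
these can be glued, run through at another speed, and passed to pointwise limits.

* Lower semicontinuity, in every dimension: nearly optimal pairs converge pointwise along an
  ultrafilter, and the limit is again driven by a control
  (`Peakon.lowerSemicontinuousOn_valueFunction`).
* Supersolution: if the inequality failed at a minimum of `v - φ`, the function `φ(x(t), t)` would
  increase by at least `δ h - ½ ∫ |α|²` along every trajectory in a time `h`, which contradicts
  dynamic programming along a nearly optimal one (`Peakon.hjb_nonpos_of_isLocalMin`).
* Subsolution: the minimizing control at a maximum is `-√E(y₀) ∇φ`. It is realized along solutions of
  `ẋ = -E(x) ∇φ(y₀, t₀)`, an equation with Lipschitz right-hand side, so that Picard–Lindelöf applies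
  from all nearby points, on a common time interval (`Peakon.hjb_nonneg_of_isLocalMax`). This is
  what the upper envelope needs.
* In the plane `E` has the eigenvalues `1 ± e^{-|x₁ - x₂|}` with fixed eigenvectors, and the
  degenerate direction is crossed at finite cost, because `∫ dd / √(1 - e^{-|d|})` converges at
  `d = 0`. Nearby points can therefore be joined cheaply, which gives upper semicontinuity
  (`Peakon.upperSemicontinuousOn_valueFunction_two`).
-/

namespace Peakon

/-! ### The matrix `E(x)` and its square root -/

/-- `E(x)` is a Gram matrix: with `min` the inner product of the indicators of intervals `(0, u]`,
`e^{-|a - b|} = e^{-a} e^{-b} min (e^{2a}) (e^{2b})`. -/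
theorem posSemidef_E {N : ℕ} (x : Space N) : (E x).PosSemidef := by
  let s : Fin N → Set ℝ := fun i => Ioc 0 (Real.exp (2 * x i))
  let v : Fin N → Lp ℝ 2 (volume : Measure ℝ) := fun i =>
    Real.exp (-x i) • indicatorConstLp 2 (s := s i) measurableSet_Ioc (by simp [s]) (1 : ℝ)
  have hs : ∀ i, volume (s i) ≠ ∞ := fun i => by simp [s]
  have h : E x = Matrix.gram ℝ v := by
    ext i j
    simp only [E, Matrix.of_apply, Matrix.gram_apply, v, inner_smul_left, inner_smul_right]
    rw [MeasureTheory.L2.inner_indicatorConstLp_indicatorConstLp _ _ (hs i) (hs j)]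
    simp only [s, Ioc_inter_Ioc, Measure.real, Real.volume_Ioc]
    rw [ENNReal.toReal_ofReal (by simp [Real.exp_nonneg])]
    rcases le_total (x i) (x j) with hij | hij
    · rw [min_eq_left (Real.exp_le_exp.2 (by linarith)), abs_of_nonpos (by linarith)]
      simp [← Real.exp_add]
      ring
    · rw [min_eq_right (Real.exp_le_exp.2 (by linarith)), abs_of_nonneg (by linarith)]
      simp [← Real.exp_add]
      ring
  rw [h]
  exact Matrix.posSemidef_gram ℝ v

theorem sqrt_mul_sqrt_E {N : ℕ} (x : Space N) : CFC.sqrt (E x) * CFC.sqrt (E x) = E x :=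
  CFC.sqrt_mul_sqrt_self _ (Matrix.nonneg_iff_posSemidef.2 (posSemidef_E x))

theorem adjoint_sqrtE {N : ℕ} (x : Space N) :
    ContinuousLinearMap.adjoint (sqrtE x) = sqrtE x := by
  change star (sqrtE x) = sqrtE x
  unfold sqrtE
  rw [← map_star]
  congr 1
  exact (CFC.sqrt_nonneg (E x)).isSelfAdjoint

theorem inner_sqrtE {N : ℕ} (x p q : Space N) :
    (inner ℝ (sqrtE x p) q : ℝ) = inner ℝ p (sqrtE x q) := by
  conv_rhs => rw [← adjoint_sqrtE]
  exact (ContinuousLinearMap.adjoint_inner_right (sqrtE x) p q).symm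

/-- The matrix `E(x)` as a continuous linear operator. -/
noncomputable def opE {N : ℕ} (x : Space N) : Space N →L[ℝ] Space N :=
  Matrix.toEuclideanCLM (n := Fin N) (𝕜 := ℝ) (E x)

theorem sqrtE_sqrtE {N : ℕ} (x p : Space N) : sqrtE x (sqrtE x p) = opE x p := by
  unfold sqrtE opE
  rw [← mul_apply_eq_comp, ← map_mul, sqrt_mul_sqrt_E]

theorem inner_opE {N : ℕ} (x p : Space N) : (inner ℝ p (opE x p) : ℝ) = ‖sqrtE x p‖ ^ 2 := by
  rw [← sqrtE_sqrtE, ← inner_sqrtE, real_inner_self_eq_norm_sq]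

theorem norm_sqrtE_sq {N : ℕ} (x p : Space N) :
    ‖sqrtE x p‖ ^ 2 = ∑ i, ∑ j, Real.exp (-|x i - x j|) * (p i * p j) := by
  rw [← inner_opE, opE, Matrix.inner_toEuclideanCLM]
  simp only [dotProduct, Matrix.mulVec, E, Matrix.of_apply, Finset.mul_sum]
  refine Finset.sum_congr rfl fun i _ => Finset.sum_congr rfl fun j _ => ?_
  ring

theorem sum_abs_mul_abs_le {N : ℕ} (p : Space N) :
    ∑ i, ∑ j, |p i| * |p j| ≤ N * ‖p‖ ^ 2 := by
  have h := sq_sum_le_card_mul_sum_sq (s := Finset.univ) (f := fun i => |p i|)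
  rw [EuclideanSpace.norm_sq_eq]
  simp only [sq_abs, Finset.card_univ, Fintype.card_fin, Real.norm_eq_abs] at h ⊢
  refine le_trans (le_of_eq ?_) h
  rw [sq, Finset.sum_mul_sum]

theorem norm_sqrtE_sq_le {N : ℕ} (x p : Space N) : ‖sqrtE x p‖ ^ 2 ≤ N * ‖p‖ ^ 2 := by
  rw [norm_sqrtE_sq]
  refine le_trans ?_ (sum_abs_mul_abs_le p)
  refine Finset.sum_le_sum fun i _ => Finset.sum_le_sum fun j _ => ?_
  rw [← abs_mul]
  refine (le_abs_self _).trans ?_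
  rw [abs_mul, abs_of_pos (Real.exp_pos _)]
  exact mul_le_of_le_one_left (abs_nonneg _) (Real.exp_le_one_iff.2 (by simp))

theorem abs_exp_neg_abs_sub_le (a b : ℝ) :
    |Real.exp (-|a|) - Real.exp (-|b|)| ≤ |a - b| := by
  wlog h : |a| ≤ |b| generalizing a b
  · rw [abs_sub_comm, abs_sub_comm a b]
    exact this b a (le_of_not_ge h)
  have h1 : Real.exp (-|b|) ≤ Real.exp (-|a|) := Real.exp_le_exp.2 (by linarith)
  rw [abs_of_nonneg (by linarith)]
  have h2 : Real.exp (-|a|) ≤ 1 := Real.exp_le_one_iff.2 (by simp)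
  have h3 : Real.exp (-|b|) = Real.exp (-|a|) * Real.exp (-(|b| - |a|)) := by
    rw [← Real.exp_add]; congr 1; ring
  have h4 := Real.add_one_le_exp (-(|b| - |a|))
  have h5 : |b| - |a| ≤ |a - b| := by
    rw [abs_sub_comm]; exact abs_sub_abs_le_abs_sub b a
  have h6 := Real.exp_pos (-|a|)
  nlinarith

theorem abs_E_sub_le {N : ℕ} (x y : Space N) (i j : Fin N) :
    |Real.exp (-|x i - x j|) - Real.exp (-|y i - y j|)| ≤ 2 * ‖x - y‖ := by
  refine (abs_exp_neg_abs_sub_le _ _).trans ?_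
  have hi := PiLp.norm_apply_le (x - y) i
  have hj := PiLp.norm_apply_le (x - y) j
  simp only [PiLp.sub_apply, Real.norm_eq_abs] at hi hj
  have := abs_sub (x i - y i) (x j - y j)
  calc |x i - x j - (y i - y j)| = |x i - y i - (x j - y j)| := by congr 1; ring
    _ ≤ _ := this
    _ ≤ _ := by linarith

/-- The quadratic form of `E` is Lipschitz in the base point, although `√E` is not. -/
theorem norm_sqrtE_sq_le_add {N : ℕ} (x y p : Space N) :
    ‖sqrtE x p‖ ^ 2 ≤ ‖sqrtE y p‖ ^ 2 + 2 * N * ‖x - y‖ * ‖p‖ ^ 2 := by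
  have : ‖sqrtE x p‖ ^ 2 - ‖sqrtE y p‖ ^ 2 ≤ 2 * ‖x - y‖ * (N * ‖p‖ ^ 2) := by
    rw [norm_sqrtE_sq, norm_sqrtE_sq, ← Finset.sum_sub_distrib]
    refine le_trans ?_ (mul_le_mul_of_nonneg_left (sum_abs_mul_abs_le p) (by positivity))
    rw [Finset.mul_sum]
    refine Finset.sum_le_sum fun i _ => ?_
    rw [← Finset.sum_sub_distrib, Finset.mul_sum]
    refine Finset.sum_le_sum fun j _ => ?_
    rw [← sub_mul, ← abs_mul]
    refine (le_abs_self _).trans ?_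
    rw [abs_mul]
    exact mul_le_mul_of_nonneg_right (abs_E_sub_le x y i j) (abs_nonneg _)
  linarith

theorem opE_apply {N : ℕ} (x p : Space N) (i : Fin N) :
    opE x p i = ∑ j, Real.exp (-|x i - x j|) * p j := by
  simp [opE, Matrix.mulVec, dotProduct, E]

theorem norm_opE_sub_le {N : ℕ} (x y p : Space N) :
    ‖opE x p - opE y p‖ ≤ N * (N * (2 * ‖x - y‖ * ‖p‖)) := by
  have hc : ∀ i, |(opE x p - opE y p) i| ≤ N * (2 * ‖x - y‖ * ‖p‖) := by
    intro i
    rw [PiLp.sub_apply, opE_apply, opE_apply, ← Finset.sum_sub_distrib]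
    refine (Finset.abs_sum_le_sum_abs _ _).trans ?_
    refine (Finset.sum_le_card_nsmul _ _ (2 * ‖x - y‖ * ‖p‖) fun j _ => ?_).trans (by simp)
    rw [← sub_mul, abs_mul]
    exact mul_le_mul (abs_E_sub_le x y i j) (PiLp.norm_apply_le p j) (abs_nonneg _)
      (by positivity)
  have h1 : ‖opE x p - opE y p‖ ≤ ∑ i, |(opE x p - opE y p) i| := by
    rw [EuclideanSpace.norm_eq, Real.sqrt_le_left (Finset.sum_nonneg fun _ _ => abs_nonneg _)]
    exact Finset.sum_sq_le_sq_sum_of_nonneg (fun _ _ => abs_nonneg _)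
  refine h1.trans ((Finset.sum_le_card_nsmul _ _ _ fun i _ => hc i).trans (by simp))

theorem continuous_opE {N : ℕ} : Continuous (opE : Space N → Space N →L[ℝ] Space N) := by
  refine continuous_clm_apply.2 fun p => ?_
  have : LipschitzWith (Real.toNNReal (N * (N * (2 * ‖p‖)))) (fun x : Space N => opE x p) :=
    LipschitzWith.of_dist_le_mul fun x y => by
      rw [dist_eq_norm, dist_eq_norm, Real.coe_toNNReal _ (by positivity)]
      exact (norm_opE_sub_le x y p).trans (le_of_eq (by ring))
  exact this.continuous

theorem hamiltonian_eq {N : ℕ} (y q : Space N) :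
    hamiltonian y q = -(1 / 2) * ‖sqrtE y q‖ ^ 2 := by
  refine le_antisymm ?_ ?_
  · refine ((isLeast_hamiltonian y q).2 ⟨-sqrtE y q, rfl⟩).trans (le_of_eq ?_)
    simp only [inner_sqrtE, inner_neg_left, real_inner_self_eq_norm_sq, norm_neg]
    ring
  · obtain ⟨a, ha⟩ := (isLeast_hamiltonian y q).1
    rw [← ha]
    simp only [inner_sqrtE]
    have := norm_add_sq_real a (sqrtE y q)
    nlinarith [sq_nonneg ‖a + sqrtE y q‖]

-- the continuity of the functional calculus needs the `C⋆`-norm on matrices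
open scoped Matrix.Norms.L2Operator in
theorem continuous_sqrtE {N : ℕ} : Continuous (sqrtE : Space N → Space N →L[ℝ] Space N) := by
  have h0 : Continuous (E : Space N → Matrix (Fin N) (Fin N) ℝ) := by
    refine continuous_matrix fun i j => ?_
    simp only [E, Matrix.of_apply]
    fun_prop
  have h1 : Continuous (fun x : Space N => CFC.sqrt (E x)) := by
    simp only [CFC.sqrt_eq_cfc]
    rw [← continuousOn_univ]
    refine ContinuousOn.cfc_nnreal_of_mem_nhdsSet (s := univ) _ (by simp) h0.continuousOn ?_ ?_
    · intro x _
      exact Matrix.nonneg_iff_posSemidef.2 (posSemidef_E x)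
    · exact NNReal.continuous_sqrt.continuousOn
  have h2 : Continuous (Matrix.toEuclideanCLM (n := Fin N) (𝕜 := ℝ)) :=
    LinearMap.continuous_of_finiteDimensional
      (Matrix.toEuclideanCLM (n := Fin N) (𝕜 := ℝ)).toAlgEquiv.toLinearMap
  exact h2.comp h1

/-! ### Absolutely continuous curves -/

/-- The increments of a monotone function over disjoint intervals add up to at most its total
increment, since the image intervals are disjoint as well. -/
theorem sum_sub_le_of_mem_disjWithin {F : ℝ → ℝ} {a b : ℝ} (hab : a ≤ b)
    (hF : MonotoneOn F (Icc a b)) {I : ℕ × (ℕ → ℝ × ℝ)}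
    (hI : I ∈ AbsolutelyContinuousOnInterval.disjWithin a b) :
    ∑ i ∈ Finset.range I.1, (F (max (I.2 i).1 (I.2 i).2) - F (min (I.2 i).1 (I.2 i).2)) ≤
      F b - F a := by
  obtain ⟨hmem, hdisj⟩ := hI
  rw [uIcc_of_le hab] at hmem
  have hmin : ∀ i ∈ Finset.range I.1, min (I.2 i).1 (I.2 i).2 ∈ Icc a b := fun i hi =>
    ⟨le_min (hmem i hi).1.1 (hmem i hi).2.1, (min_le_left _ _).trans (hmem i hi).1.2⟩
  have hmax : ∀ i ∈ Finset.range I.1, max (I.2 i).1 (I.2 i).2 ∈ Icc a b := fun i hi =>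
    ⟨(hmem i hi).1.1.trans (le_max_left _ _), max_le (hmem i hi).1.2 (hmem i hi).2.2⟩
  let J : ℕ → Set ℝ := fun i => Ioc (F (min (I.2 i).1 (I.2 i).2)) (F (max (I.2 i).1 (I.2 i).2))
  have hJ : Set.PairwiseDisjoint (Finset.range I.1 : Set ℕ) J := by
    intro i hi j hj hij
    have hd := hdisj hi hj hij
    simp only [Function.onFun, J] at hd ⊢
    rw [uIoc, uIoc, Ioc_disjoint_Ioc] at hd
    rw [Ioc_disjoint_Ioc]
    have hi' := hmin i hi
    have hi'' := hmax i hi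
    have hj' := hmin j hj
    have hj'' := hmax j hj
    rcases min_le_iff.1 hd with h | h <;> rcases le_max_iff.1 h with h | h
    · exact (min_le_left _ _).trans ((hF hi'' hi' h).trans (le_max_left _ _))
    · exact (min_le_left _ _).trans ((hF hi'' hj' h).trans (le_max_right _ _))
    · exact (min_le_right _ _).trans ((hF hj'' hi' h).trans (le_max_left _ _))
    · exact (min_le_right _ _).trans ((hF hj'' hj' h).trans (le_max_right _ _))
  have hvol : ∑ i ∈ Finset.range I.1, volume (J i) ≤ volume (Ioc (F a) (F b)) := by
    rw [← measure_biUnion_finset hJ fun i _ => measurableSet_Ioc]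
    refine measure_mono (iUnion₂_subset fun i hi => Ioc_subset_Ioc ?_ ?_)
    · exact hF (left_mem_Icc.2 hab) (hmin i hi) (hmin i hi).1
    · exact hF (hmax i hi) (right_mem_Icc.2 hab) (hmax i hi).2
  simp only [J, Real.volume_Ioc] at hvol
  rw [← ENNReal.ofReal_sum_of_nonneg, ENNReal.ofReal_le_ofReal_iff] at hvol
  · exact hvol
  · exact sub_nonneg.2 (hF (left_mem_Icc.2 hab) (right_mem_Icc.2 hab) hab)
  · exact fun i hi => sub_nonneg.2 (hF (hmin i hi) (hmax i hi) min_le_max)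

/-- A curve whose squared increments are dominated by the increments of time times those of a
monotone function is absolutely continuous, by the Cauchy–Schwarz inequality. -/
theorem absolutelyContinuousOnInterval_of_dist_sq_le {X : Type*} [PseudoMetricSpace X]
    {x : ℝ → X} {F : ℝ → ℝ} {a b C : ℝ} (hab : a ≤ b) (hC : 0 ≤ C)
    (hF : MonotoneOn F (Icc a b))
    (h : ∀ s t, a ≤ s → s ≤ t → t ≤ b → dist (x s) (x t) ^ 2 ≤ C * (t - s) * (F t - F s)) :
    AbsolutelyContinuousOnInterval x a b := by
  rw [absolutelyContinuousOnInterval_iff]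
  intro ε hε
  have hFab : 0 ≤ F b - F a := sub_nonneg.2 (hF (left_mem_Icc.2 hab) (right_mem_Icc.2 hab) hab)
  have hpos : 0 < C * (F b - F a) + 1 := by positivity
  refine ⟨ε ^ 2 / (C * (F b - F a) + 1), by positivity, fun I hI hlt => ?_⟩
  have hsum := sum_sub_le_of_mem_disjWithin hab hF hI
  have hmem := hI.1
  rw [uIcc_of_le hab] at hmem
  have hsq : (∑ i ∈ Finset.range I.1, dist (x (I.2 i).1) (x (I.2 i).2)) ^ 2 ≤
      (∑ i ∈ Finset.range I.1, C * dist (I.2 i).1 (I.2 i).2) *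
      ∑ i ∈ Finset.range I.1, (F (max (I.2 i).1 (I.2 i).2) - F (min (I.2 i).1 (I.2 i).2)) := by
    refine Finset.sum_sq_le_sum_mul_sum_of_sq_le_mul _ (fun i _ => by positivity) ?_ ?_
    · intro i hi
      refine sub_nonneg.2 (hF ⟨le_min (hmem i hi).1.1 (hmem i hi).2.1,
        (min_le_left _ _).trans (hmem i hi).1.2⟩ ⟨(hmem i hi).1.1.trans (le_max_left _ _),
        max_le (hmem i hi).1.2 (hmem i hi).2.2⟩ min_le_max)
    · intro i hi
      obtain ⟨h1, h2⟩ := hmem i hi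
      rcases le_total (I.2 i).1 (I.2 i).2 with hle | hle
      · rw [max_eq_right hle, min_eq_left hle, Real.dist_eq, abs_sub_comm,
          abs_of_nonneg (sub_nonneg.2 hle)]
        exact h _ _ h1.1 hle h2.2
      · rw [max_eq_left hle, min_eq_right hle, Real.dist_eq,
          abs_of_nonneg (sub_nonneg.2 hle), dist_comm]
        exact h _ _ h2.1 hle h1.2
  rw [← Finset.mul_sum] at hsq
  rw [lt_div_iff₀ hpos] at hlt
  set S := ∑ i ∈ Finset.range I.1, dist (I.2 i).1 (I.2 i).2
  have hS : 0 ≤ S := Finset.sum_nonneg fun _ _ => dist_nonneg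
  refine lt_of_pow_lt_pow_left₀ 2 hε.le (hsq.trans_lt ?_)
  calc _ ≤ C * S * (F b - F a) := mul_le_mul_of_nonneg_left hsum (by positivity)
    _ ≤ S * (C * (F b - F a) + 1) := by nlinarith
    _ < ε ^ 2 := hlt

theorem absolutelyContinuousOnInterval_of_dist_le {X Y : Type*} [PseudoMetricSpace X]
    [PseudoMetricSpace Y] {x : ℝ → X} {f : ℝ → Y} {a b K : ℝ}
    (hx : AbsolutelyContinuousOnInterval x a b)
    (h : ∀ s ∈ uIcc a b, ∀ t ∈ uIcc a b, dist (f s) (f t) ≤ K * (dist (x s) (x t) + dist s t)) :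
    AbsolutelyContinuousOnInterval f a b := by
  have hid : AbsolutelyContinuousOnInterval (fun t : ℝ => t) a b :=
    LipschitzWith.id.lipschitzOnWith.absolutelyContinuousOnInterval
  unfold AbsolutelyContinuousOnInterval at hx hid ⊢
  have h0 := (hx.add hid).const_mul K
  simp only [add_zero, mul_zero] at h0
  refine tendsto_of_tendsto_of_tendsto_of_le_of_le' tendsto_const_nhds h0
    (Eventually.of_forall fun _ => Finset.sum_nonneg fun _ _ => dist_nonneg) ?_
  filter_upwards [mem_inf_of_right (mem_principal_self _)] with I hI
  rw [← Finset.sum_add_distrib, Finset.mul_sum]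
  exact Finset.sum_le_sum fun i hi => h _ (hI.1 i hi).1 _ (hI.1 i hi).2

theorem sub_le_integral_of_ae_deriv_le {f h : ℝ → ℝ} {a b : ℝ} (hab : a ≤ b)
    (hf : AbsolutelyContinuousOnInterval f a b) (hh : IntervalIntegrable h volume a b)
    (hle : ∀ᵐ t ∂(volume.restrict (Ioo a b)), deriv f t ≤ h t) :
    f b - f a ≤ ∫ t in a..b, h t := by
  rw [← hf.integral_deriv_eq_sub]
  refine intervalIntegral.integral_mono_ae_restrict hab hf.intervalIntegrable_deriv hh ?_
  rwa [← restrict_Ioo_eq_restrict_Icc]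

/-- A `C¹` function of a point and of time is absolutely continuous along every absolutely
continuous curve, because it is Lipschitz on compact convex sets. -/
theorem absolutelyContinuousOnInterval_comp_contDiffOn {V : Type*} [NormedAddCommGroup V]
    [NormedSpace ℝ V] [FiniteDimensional ℝ V] {φ : V × ℝ → ℝ} {T a b : ℝ}
    (hφ : ContDiffOn ℝ 1 φ (univ ×ˢ Ioo 0 T)) {x : ℝ → V} (ha : 0 < a) (hab : a ≤ b)
    (hb : b < T) (hx : AbsolutelyContinuousOnInterval x a b) :
    AbsolutelyContinuousOnInterval (fun t => φ (x t, t)) a b := by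
  obtain ⟨R, hR⟩ := hx.exists_bound
  have hsub : Metric.closedBall (0 : V) R ×ˢ Icc a b ⊆ univ ×ˢ Ioo 0 T := fun p hp =>
    ⟨mem_univ _, ha.trans_le hp.2.1, hp.2.2.trans_lt hb⟩
  obtain ⟨K, hK⟩ := (hφ.mono hsub).exists_lipschitzOnWith (by decide)
    ((convex_closedBall _ _).prod (convex_Icc a b))
    ((isCompact_closedBall _ _).prod isCompact_Icc)
  refine absolutelyContinuousOnInterval_of_dist_le (K := K) hx fun s hs t ht => ?_
  have hmem : ∀ r ∈ uIcc a b, (x r, r) ∈ Metric.closedBall (0 : V) R ×ˢ Icc a b := fun r hr =>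
    ⟨by simpa using hR r hr, by rwa [uIcc_of_le hab] at hr⟩
  refine (hK.dist_le_mul _ (hmem s hs) _ (hmem t ht)).trans ?_
  refine mul_le_mul_of_nonneg_left ?_ K.2
  rw [Prod.dist_eq]
  exact max_le_add_of_nonneg dist_nonneg dist_nonneg

/-! ### Curves of bounded action -/

/-- The curve `x` has on `[a, b]` an action of increments at most those of `F`. This is the dual
formulation of `½ ∫_s^t |α|² ≤ F(t) - F(s)` for a control `α` driving `x`: by Young's inequality
`p · √E(x) α ≤ ½ |α|² + ½ |√E(x) p|²`, where the last term is replaced by an upper bound `c / 2`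
on `[s, t]`. No control and no derivative occurs in it, so that it can be glued, rescaled in time,
and passed to the limit. -/
def IsAction {N : ℕ} (a b : ℝ) (x : ℝ → Space N) (F : ℝ → ℝ) : Prop :=
  ∀ s t, a ≤ s → s ≤ t → t ≤ b → ∀ (p : Space N) (c : ℝ),
    (∀ r ∈ Icc s t, ‖sqrtE (x r) p‖ ^ 2 ≤ c) →
      inner ℝ p (x t - x s) ≤ F t - F s + (t - s) / 2 * c

namespace IsAction

variable {N : ℕ} {a b : ℝ} {x : ℝ → Space N} {F : ℝ → ℝ}

theorem mono (h : IsAction a b x F) {a' b' : ℝ} (ha : a ≤ a') (hb : b' ≤ b) :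
    IsAction a' b' x F :=
  fun s t hs hst ht => h s t (ha.trans hs) hst (ht.trans hb)

theorem monotoneOn (h : IsAction a b x F) : MonotoneOn F (Icc a b) := by
  intro s hs t ht hst
  have := h s t hs.1 hst ht.2 0 0 (by simp)
  simp at this
  exact this

/-- Curves of bounded action are Hölder continuous of exponent `1/2`. -/
theorem norm_sub_sq_le (h : IsAction a b x F) {s t : ℝ} (hs : a ≤ s) (hst : s ≤ t) (ht : t ≤ b) :
    ‖x t - x s‖ ^ 2 ≤ 2 * (N + 1) * (t - s) * (F t - F s) := by
  have key : ∀ l : ℝ, l * ‖x t - x s‖ ^ 2 ≤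
      F t - F s + (t - s) / 2 * ((N + 1) * (l ^ 2 * ‖x t - x s‖ ^ 2)) := by
    intro l
    have := h s t hs hst ht (l • (x t - x s)) ((N + 1) * (l ^ 2 * ‖x t - x s‖ ^ 2)) ?_
    · rwa [inner_smul_left, real_inner_self_eq_norm_sq] at this
    · intro r _
      refine (norm_sqrtE_sq_le _ _).trans ?_
      rw [norm_smul, mul_pow, Real.norm_eq_abs, sq_abs]
      have : 0 ≤ l ^ 2 * ‖x t - x s‖ ^ 2 := by positivity
      nlinarith
  have hN : (0 : ℝ) < N + 1 := by positivity
  rcases hst.eq_or_lt with rfl | hlt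
  · simp
  · have hpos : 0 < (N + 1) * (t - s) := mul_pos hN (sub_pos.2 hlt)
    -- the multiple of the increment as momentum that balances both sides
    have := key (1 / ((N + 1) * (t - s)))
    have e : (t - s) / 2 * ((N + 1) * ((1 / ((N + 1) * (t - s))) ^ 2 * ‖x t - x s‖ ^ 2)) =
        1 / ((N + 1) * (t - s)) * ‖x t - x s‖ ^ 2 / 2 := by
      have := sub_pos.2 hlt
      field_simp
    rw [e] at this
    have h2 : ‖x t - x s‖ ^ 2 / ((N + 1) * (t - s)) ≤ 2 * (F t - F s) := by
      rw [div_eq_mul_one_div, mul_comm]; linarith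
    rw [div_le_iff₀ hpos] at h2
    linarith

/-- The dual inequality with `√E` frozen at the left end point, at the price of an error of higher
order in `t - s`. -/
theorem inner_sub_le (h : IsAction a b x F) {s t : ℝ} (hs : a ≤ s) (hst : s ≤ t) (ht : t ≤ b)
    {M : ℝ} (hM : F b - F a ≤ M) (p : Space N) :
    inner ℝ p (x t - x s) ≤ F t - F s + (t - s) / 2 *
      (‖sqrtE (x s) p‖ ^ 2 + 2 * N * Real.sqrt (2 * (N + 1) * (t - s) * M) * ‖p‖ ^ 2) := by
  refine h s t hs hst ht p _ fun r hr => (norm_sqrtE_sq_le_add (x r) (x s) p).trans ?_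
  have hab : a ≤ b := hs.trans (hst.trans ht)
  have h1 : ‖x r - x s‖ ≤ Real.sqrt (2 * (N + 1) * (t - s) * M) := by
    refine Real.le_sqrt_of_sq_le ((h.norm_sub_sq_le hs hr.1 (hr.2.trans ht)).trans ?_)
    have m1 := h.monotoneOn ⟨hs.trans hr.1, hr.2.trans ht⟩ (right_mem_Icc.2 hab) (hr.2.trans ht)
    have m2 := h.monotoneOn (left_mem_Icc.2 hab) ⟨hs, hst.trans ht⟩ hs
    have m3 := h.monotoneOn ⟨hs, hst.trans ht⟩ ⟨hs.trans hr.1, hr.2.trans ht⟩ hr.1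
    have e1 : r - s ≤ t - s := by linarith [hr.2]
    have e2 : F r - F s ≤ M := by linarith
    have e3 : 0 ≤ r - s := sub_nonneg.2 hr.1
    have e4 : (0 : ℝ) ≤ 2 * (N + 1) := by positivity
    exact mul_le_mul (mul_le_mul_of_nonneg_left e1 e4) e2 (by linarith)
      (mul_nonneg e4 (by linarith))
  gcongr

theorem trans {m : ℝ} {z : ℝ → Space N} {G : ℝ → ℝ} (h : IsAction a m x F)
    (h' : IsAction m b z G) (hm : x m = z m) :
    IsAction a b (fun t => if t ≤ m then x t else z t)
      (fun t => if t ≤ m then F t else F m + (G t - G m)) := by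
  intro s t hs hst ht p c hc
  dsimp only at hc ⊢
  by_cases htm : t ≤ m
  · rw [if_pos htm, if_pos (hst.trans htm), if_pos htm, if_pos (hst.trans htm)]
    refine h s t hs hst htm p c fun r hr => ?_
    have := hc r hr
    rwa [if_pos (hr.2.trans htm)] at this
  · have htm' := (not_le.1 htm).le
    by_cases hsm : s ≤ m
    · rw [if_neg htm, if_pos hsm, if_neg htm, if_pos hsm]
      have e1 := h s m hs hsm le_rfl p c fun r hr => by
        have := hc r ⟨hr.1, hr.2.trans htm'⟩
        rwa [if_pos hr.2] at this
      have e2 := h' m t le_rfl htm' ht p c fun r hr => by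
        have := hc r ⟨hsm.trans hr.1, hr.2⟩
        rcases hr.1.eq_or_lt with rfl | hlt
        · rwa [if_pos le_rfl, hm] at this
        · rwa [if_neg (not_le.2 hlt)] at this
      have e3 : z t - x s = (x m - x s) + (z t - z m) := by rw [hm]; abel
      rw [e3, inner_add_right]
      linarith
    · have hsm' := not_le.1 hsm
      rw [if_neg htm, if_neg hsm, if_neg htm, if_neg hsm]
      have := h' s t hsm'.le hst ht p c fun r hr => by
        have := hc r hr
        rwa [if_neg (not_le.2 (hsm'.trans_le hr.1))] at this
      linarith

/-- Running through a curve at `l` times the speed multiplies its action by `l`. -/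
theorem comp_affine {a' b' l : ℝ} (h : IsAction a b x F) (hl : 0 < l)
    (hb : a + l * (b' - a') ≤ b) :
    IsAction a' b' (fun t => x (a + l * (t - a'))) (fun t => l * F (a + l * (t - a'))) := by
  intro s t hs hst ht p c hc
  dsimp only at hc ⊢
  have h1 := h (a + l * (s - a')) (a + l * (t - a')) (by nlinarith) (by nlinarith) (by nlinarith)
    (l⁻¹ • p) (l⁻¹ ^ 2 * c) fun r hr => by
      have := hc (a' + (r - a) / l) ⟨by
        rw [← sub_le_iff_le_add', le_div_iff₀ hl]; linarith [hr.1], by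
        rw [← le_sub_iff_add_le', div_le_iff₀ hl]; linarith [hr.2]⟩
      rw [show a + l * (a' + (r - a) / l - a') = r by field_simp; ring] at this
      rw [map_smul, norm_smul, mul_pow, Real.norm_eq_abs, sq_abs]
      exact mul_le_mul_of_nonneg_left this (by positivity)
  rw [inner_smul_left] at h1
  simp only [conj_trivial] at h1
  have h2 := mul_le_mul_of_nonneg_left h1 hl.le
  rw [← mul_assoc, mul_inv_cancel₀ hl.ne', one_mul] at h2
  refine h2.trans (le_of_eq ?_)
  field_simp
  ring

end IsAction

/-- A differentiable curve satisfying the pointwise dual inequality with constant power `K`. -/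
theorem isAction_of_hasDerivAt {N : ℕ} {a b K : ℝ} {x x' : ℝ → Space N}
    (hx : ContinuousOn x (Icc a b)) (hd : ∀ t ∈ Ioo a b, HasDerivAt x (x' t) t)
    (hK : ∀ t ∈ Ioo a b, ∀ p : Space N, inner ℝ p (x' t) ≤ K + 1 / 2 * ‖sqrtE (x t) p‖ ^ 2) :
    IsAction a b x (fun t => K * t) := by
  intro s t hs hst ht p c hc
  have hd' : ∀ r ∈ Ioo s t, HasDerivAt (fun r => K * r + c / 2 * r - inner ℝ p (x r))
      (K * 1 + c / 2 * 1 - inner ℝ p (x' r)) r := fun r hr =>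
    (((hasDerivAt_id r).const_mul K).add ((hasDerivAt_id r).const_mul (c / 2))).sub
      ((innerSL ℝ p).hasFDerivAt.comp_hasDerivAt r (hd r ⟨hs.trans_lt hr.1, hr.2.trans_le ht⟩))
  have hmono : MonotoneOn (fun r => K * r + c / 2 * r - inner ℝ p (x r)) (Icc s t) := by
    refine monotoneOn_of_deriv_nonneg (convex_Icc s t) ?_ ?_ ?_
    · have := hx.mono (Icc_subset_Icc hs ht)
      fun_prop
    · intro r hr
      rw [interior_Icc] at hr
      exact (hd' r hr).differentiableAt.differentiableWithinAt
    · intro r hr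
      rw [interior_Icc] at hr
      rw [(hd' r hr).deriv]
      have h2 := hK r ⟨hs.trans_lt hr.1, hr.2.trans_le ht⟩ p
      have h3 := hc r (Ioo_subset_Icc_self hr)
      linarith
  have := hmono (left_mem_Icc.2 hst) (right_mem_Icc.2 hst) hst
  dsimp only at this
  rw [inner_sub_right]
  linarith

theorem integrableOn_norm_sq_of_lintegral {V : Type*} [NormedAddCommGroup V] [MeasurableSpace V]
    [BorelSpace V] [SecondCountableTopology V] {s : Set ℝ} {α : ℝ → V}
    (hm : AEMeasurable α (volume.restrict s)) (hfin : ∫⁻ t in s, ‖α t‖ₑ ^ 2 ≠ ∞) :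
    IntegrableOn (fun t => ‖α t‖ ^ 2) s := by
  refine ⟨(hm.norm.pow_const 2).aestronglyMeasurable, ?_⟩
  rw [hasFiniteIntegral_iff_enorm]
  simpa using hfin.lt_top

/-- Along a trajectory of finite energy, `½ ∫ |α|²` dominates the action. -/
theorem IsTrajectory.isAction {N : ℕ} {T t₀ : ℝ} {α : ℝ → Space N} {y₀ : Space N}
    {x : ℝ → Space N} (hx : IsTrajectory T α y₀ t₀ x)
    (hα : IntervalIntegrable (fun t => 1 / 2 * ‖α t‖ ^ 2) volume t₀ T) :
    IsAction t₀ T x (fun t => ∫ r in t₀..t, 1 / 2 * ‖α r‖ ^ 2) := by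
  intro s t hs hst ht p c hc
  have hsub : ∀ u v, u ∈ Icc t₀ T → v ∈ Icc t₀ T →
      IntervalIntegrable (fun t => 1 / 2 * ‖α t‖ ^ 2) volume u v := fun u v hu hv =>
    hα.mono_set (by
      rw [uIcc_of_le (hu.1.trans hu.2)]
      exact uIcc_subset_Icc hu hv)
  have hs' : s ∈ Icc t₀ T := ⟨hs, hst.trans ht⟩
  have ht' : t ∈ Icc t₀ T := ⟨hs.trans hst, ht⟩
  have h0 : t₀ ∈ Icc t₀ T := ⟨le_rfl, hs.trans hs'.2⟩
  rw [intervalIntegral.integral_interval_sub_left (hsub _ _ h0 ht') (hsub _ _ h0 hs')]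
  have hac : AbsolutelyContinuousOnInterval (fun r => inner ℝ p (x r) : ℝ → ℝ) s t := by
    refine absolutelyContinuousOnInterval_of_dist_le (K := ‖p‖)
      (hx.absolutelyContinuous.mono (uIcc_subset_uIcc ?_ ?_)) fun u _ v _ => ?_
    · rwa [uIcc_of_le h0.2]
    · rwa [uIcc_of_le h0.2]
    · rw [Real.dist_eq, ← inner_sub_right, dist_eq_norm]
      refine (abs_real_inner_le_norm _ _).trans ?_
      have := mul_nonneg (norm_nonneg p) (dist_nonneg (x := u) (y := v))
      linarith
  have := sub_le_integral_of_ae_deriv_le hst hac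
    (h := fun r => 1 / 2 * ‖α r‖ ^ 2 + c / 2) ((hsub _ _ hs' ht').add (by simp)) ?_
  · rw [intervalIntegral.integral_add (hsub _ _ hs' ht') (by simp),
      intervalIntegral.integral_const, smul_eq_mul] at this
    rw [inner_sub_right]
    linarith
  · have h1 := ae_restrict_of_ae_restrict_of_subset (Ioo_subset_Ioo hs ht) hx.hasDerivAt
    filter_upwards [h1, ae_restrict_mem measurableSet_Ioo] with r hr hmem
    have h2 : HasDerivAt (fun r => inner ℝ p (x r) : ℝ → ℝ) (inner ℝ p (sqrtE (x r) (α r))) r :=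
      (innerSL ℝ p).hasFDerivAt.comp_hasDerivAt r hr
    rw [h2.deriv, ← inner_sqrtE]
    have h3 := hc r (Ioo_subset_Icc_self hmem)
    have h4 := norm_sub_sq_real (sqrtE (x r) p) (α r)
    nlinarith [sq_nonneg ‖sqrtE (x r) p - α r‖]

/-! ### Recovering a control from the action -/

/-- The resolvent `(E(y) + ε)⁻¹`. -/
noncomputable def resolvent {N : ℕ} (ε : ℝ) (y : Space N) : Space N →L[ℝ] Space N :=
  Ring.inverse (opE y + ε • ContinuousLinearMap.id ℝ (Space N))

theorem isUnit_opE_add {N : ℕ} {ε : ℝ} (hε : 0 < ε) (y : Space N) :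
    IsUnit (opE y + ε • ContinuousLinearMap.id ℝ (Space N)) := by
  have hinj : Function.Injective (opE y + ε • ContinuousLinearMap.id ℝ (Space N)) := by
    rw [injective_iff_map_eq_zero]
    intro p hp
    have h1 : inner ℝ p ((opE y + ε • ContinuousLinearMap.id ℝ (Space N)) p) = (0 : ℝ) := by
      rw [hp, inner_zero_right]
    simp only [add_apply, smul_apply,
      ContinuousLinearMap.id_apply, inner_add_right, inner_smul_right, inner_opE,
      real_inner_self_eq_norm_sq] at h1
    have h2 : ε * ‖p‖ ^ 2 = 0 := by nlinarith [sq_nonneg ‖sqrtE y p‖, sq_nonneg ‖p‖]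
    simpa [hε.ne'] using h2
  rw [ContinuousLinearMap.isUnit_iff_bijective]
  have := LinearMap.injective_iff_surjective
    (f := (opE y + ε • ContinuousLinearMap.id ℝ (Space N)).toLinearMap)
  exact ⟨hinj, this.1 hinj⟩

theorem opE_resolvent {N : ℕ} {ε : ℝ} (hε : 0 < ε) (y v : Space N) :
    opE y (resolvent ε y v) + ε • resolvent ε y v = v := by
  have h := Ring.mul_inverse_cancel _ (isUnit_opE_add hε y)
  have h2 := congrArg (fun f : Space N →L[ℝ] Space N => f v) h
  simpa [resolvent] using h2

theorem continuous_resolvent {N : ℕ} {ε : ℝ} (hε : 0 < ε) :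
    Continuous (resolvent ε : Space N → Space N →L[ℝ] Space N) := by
  refine continuous_iff_continuousAt.2 fun y => ?_
  have h1 : ContinuousAt Ring.inverse (opE y + ε • ContinuousLinearMap.id ℝ (Space N)) := by
    obtain ⟨u, hu⟩ := isUnit_opE_add hε y
    rw [← hu]
    exact NormedRing.inverse_continuousAt u
  exact ContinuousAt.comp (f := fun y : Space N => opE y + ε • ContinuousLinearMap.id ℝ (Space N))
    h1 (continuous_opE.add continuous_const).continuousAt

/-- Tikhonov regularization: `√E (E + ε)⁻¹ v` tends to the solution `√E u` of `√E a = v`. -/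
theorem norm_sqrtE_resolvent_sub_sq_le {N : ℕ} {ε : ℝ} (hε : 0 < ε) (y u : Space N) :
    ‖sqrtE y (resolvent ε y (opE y u)) - sqrtE y u‖ ^ 2 ≤ ε * (‖u‖ ^ 2 / 4) := by
  set p := resolvent ε y (opE y u) with hp
  have h1 : opE y (p - u) = -(ε • p) := by
    rw [map_sub, ← opE_resolvent hε y (opE y u), ← hp]
    abel
  rw [← map_sub, ← inner_opE, h1, inner_neg_right, inner_smul_right, inner_sub_left,
    real_inner_self_eq_norm_sq]
  have h2 := real_inner_le_norm u p
  nlinarith [sq_nonneg (‖p‖ - ‖u‖ / 2)]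

theorem tendsto_sqrtE_resolvent {N : ℕ} (y u : Space N) :
    Tendsto (fun n : ℕ => sqrtE y (resolvent (1 / ((n : ℝ) + 1)) y (opE y u))) atTop
      (𝓝 (sqrtE y u)) := by
  rw [tendsto_iff_norm_sub_tendsto_zero]
  have h1 : Tendsto (fun n : ℕ => Real.sqrt (1 / ((n : ℝ) + 1) * (‖u‖ ^ 2 / 4))) atTop (𝓝 0) := by
    have := (tendsto_one_div_add_atTop_nhds_zero_nat (𝕜 := ℝ)).mul_const (‖u‖ ^ 2 / 4)
    have := (Real.continuous_sqrt.tendsto _).comp this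
    simpa [Function.comp_def] using this
  refine squeeze_zero (fun _ => norm_nonneg _) (fun n => ?_) h1
  exact Real.le_sqrt_of_sq_le (norm_sqrtE_resolvent_sub_sq_le (by positivity) y u)

/-- A velocity satisfying the pointwise dual inequality is `√E a` for a control `a = √E u` with
`½ |a|² ≤ f`. -/
theorem exists_opE_eq_of_forall_inner_le {N : ℕ} {y v : Space N} {f : ℝ}
    (h : ∀ p : Space N, inner ℝ p v ≤ f + 1 / 2 * ‖sqrtE y p‖ ^ 2) :
    ∃ u, opE y u = v ∧ 1 / 2 * ‖sqrtE y u‖ ^ 2 ≤ f := by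
  have hsymm : (opE y).toLinearMap.IsSymmetric := fun p q => by
    change inner ℝ (opE y p) q = inner ℝ p (opE y q)
    rw [← sqrtE_sqrtE, ← sqrtE_sqrtE, inner_sqrtE, inner_sqrtE]
  have hv : v ∈ (opE y).toLinearMap.range := by
    rw [← Submodule.orthogonal_orthogonal (opE y).toLinearMap.range, hsymm.orthogonal_range,
      Submodule.mem_orthogonal]
    intro p hp
    have hp' : opE y p = 0 := hp
    have hS : ∀ l : ℝ, ‖sqrtE y (l • p)‖ ^ 2 = 0 := fun l => by
      rw [← inner_opE, map_smul, hp']; simp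
    -- a momentum in the kernel of `E` costs nothing, hence scaling it leaves no room for `p · v ≠ 0`
    by_contra hne
    have := h (((f + 1) / inner ℝ p v) • p)
    rw [hS, inner_smul_left, conj_trivial, div_mul_cancel₀ _ hne] at this
    linarith
  obtain ⟨u, hu⟩ := hv
  have hu' : opE y u = v := hu
  refine ⟨u, hu', ?_⟩
  have := h u
  rw [← hu', inner_opE] at this
  linarith

/-- A curve with a dual action bound is driven by a control whose energy is at most the action.
The bound is only needed up to an error of higher order; it is differentiated at almost every time,
and the measurability of the control comes from Tikhonov regularization. -/
theorem exists_isTrajectory {N : ℕ} {a b C K : ℝ} {x : ℝ → Space N} {F : ℝ → ℝ} (hab : a ≤ b)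
    (hC : 0 ≤ C) (hF : MonotoneOn F (Icc a b))
    (h1 : ∀ s t, a ≤ s → s ≤ t → t ≤ b → ‖x t - x s‖ ^ 2 ≤ C * (t - s) * (F t - F s))
    (h2 : ∀ s t, a < s → s ≤ t → t ≤ b → ∀ p : Space N, inner ℝ p (x t - x s) ≤
      F t - F s + (t - s) / 2 * (‖sqrtE (x s) p‖ ^ 2 + K * Real.sqrt (t - s) * ‖p‖ ^ 2)) :
    ∃ α : ℝ → Space N, AEMeasurable α ∧ IsTrajectory b α (x a) a x ∧
      1 / 2 * ∫⁻ t in Ioo a b, ‖α t‖ₑ ^ 2 ≤ ENNReal.ofReal (F b - F a) := by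
  have hac : AbsolutelyContinuousOnInterval x a b :=
    absolutelyContinuousOnInterval_of_dist_sq_le hab hC hF fun s t hs hst ht => by
      rw [dist_comm, dist_eq_norm]; exact h1 s t hs hst ht
  have hxd : ∀ᵐ t ∂(volume.restrict (Ioo a b)), DifferentiableAt ℝ x t := by
    rw [ae_restrict_iff' measurableSet_Ioo]
    filter_upwards [hac.boundedVariationOn.ae_differentiableAt_of_mem_uIcc] with t ht hmem
    exact ht (by rw [uIcc_of_le hab]; exact Ioo_subset_Icc_self hmem)
  have hFd : ∀ᵐ t ∂(volume.restrict (Ioo a b)), DifferentiableAt ℝ F t := by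
    rw [ae_restrict_iff' measurableSet_Ioo]
    filter_upwards [hF.ae_differentiableWithinAt_of_mem] with t ht hmem
    exact (ht (Ioo_subset_Icc_self hmem)).differentiableAt (Icc_mem_nhds hmem.1 hmem.2)
  have hpt : ∀ᵐ t ∂(volume.restrict (Ioo a b)), ∃ u, opE (x t) u = deriv x t ∧
      1 / 2 * ‖sqrtE (x t) u‖ ^ 2 ≤ deriv F t := by
    filter_upwards [hxd, hFd, ae_restrict_mem measurableSet_Ioo] with s hxs hFs hs
    refine exists_opE_eq_of_forall_inner_le fun p => ?_
    have l1 : Tendsto (fun t => inner ℝ p (slope x s t)) (𝓝[>] s) (𝓝 (inner ℝ p (deriv x s))) :=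
      ((innerSL ℝ p).continuous.tendsto _).comp
        (hxs.hasDerivAt.tendsto_slope.mono_left (nhdsWithin_mono _ fun t ht => ne_of_gt ht))
    have l2 : Tendsto (fun t => slope F s t +
        1 / 2 * (‖sqrtE (x s) p‖ ^ 2 + K * Real.sqrt (t - s) * ‖p‖ ^ 2)) (𝓝[>] s)
        (𝓝 (deriv F s + 1 / 2 * (‖sqrtE (x s) p‖ ^ 2 + K * Real.sqrt (s - s) * ‖p‖ ^ 2))) := by
      refine (hFs.hasDerivAt.tendsto_slope.mono_left
        (nhdsWithin_mono _ fun t ht => ne_of_gt ht)).add ?_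
      refine Tendsto.mono_left (Continuous.tendsto ?_ s) nhdsWithin_le_nhds
      fun_prop
    have := le_of_tendsto_of_tendsto l1 l2 ?_
    · simpa using this
    · filter_upwards [Ioo_mem_nhdsGT hs.2] with t ht
      have hts : 0 < t - s := sub_pos.2 ht.1
      have := h2 s t hs.1 ht.1.le ht.2.le p
      rw [slope_def_module, slope_def_field, inner_smul_right, inv_mul_le_iff₀ hts]
      refine this.trans (le_of_eq ?_)
      field_simp
  -- `√E u` is the limit of measurable functions of time, since `u` is a preimage of `ẋ`
  choose! u hu using fun t (ht : ∃ u, opE (x t) u = deriv x t ∧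
    1 / 2 * ‖sqrtE (x t) u‖ ^ 2 ≤ deriv F t) => ht
  have hcont : ContinuousOn x (Ioo a b) := by
    have := hac.continuousOn
    rw [uIcc_of_le hab] at this
    exact this.mono Ioo_subset_Icc_self
  have hm : AEMeasurable (fun t => sqrtE (x t) (u t)) (volume.restrict (Ioo a b)) := by
    refine aemeasurable_of_tendsto_metrizable_ae atTop (f := fun (n : ℕ) t =>
      sqrtE (x t) (resolvent (1 / ((n : ℝ) + 1)) (x t) (deriv x t))) (fun n => ?_) ?_
    · have e1 : AEMeasurable (fun t => (sqrtE (x t)).comp (resolvent (1 / ((n : ℝ) + 1)) (x t)))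
          (volume.restrict (Ioo a b)) := by
        refine ContinuousOn.aemeasurable ?_ measurableSet_Ioo
        exact (continuous_sqrtE.comp_continuousOn hcont).clm_comp
          ((continuous_resolvent (by positivity)).comp_continuousOn hcont)
      have e2 : AEMeasurable (deriv x) (volume.restrict (Ioo a b)) :=
        (measurable_deriv x).aemeasurable
      exact (isBoundedBilinearMap_apply (𝕜 := ℝ) (E := Space N)
        (F := Space N)).continuous.measurable.comp_aemeasurable (e1.prodMk e2)
    · filter_upwards [hpt] with t ht
      rw [← (hu t ht).1]
      exact tendsto_sqrtE_resolvent _ _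
  refine ⟨(Ioo a b).indicator fun t => sqrtE (x t) (u t),
    (aemeasurable_indicator_iff measurableSet_Ioo).2 hm, ⟨hac, ?_, rfl⟩, ?_⟩
  · filter_upwards [hpt, hxd, ae_restrict_mem measurableSet_Ioo] with t ht hxt hmem
    rw [indicator_of_mem hmem, sqrtE_sqrtE, (hu t ht).1]
    exact hxt.hasDerivAt
  · rw [← lintegral_const_mul' _ _ (by simp)]
    have hFi : IntegrableOn (deriv F) (Ioo a b) := by
      have := MonotoneOn.intervalIntegrable_deriv (a := a) (b := b) (f := F)
        (by rwa [uIcc_of_le hab])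
      rw [intervalIntegrable_iff_integrableOn_Ioo_of_le hab] at this
      exact this
    have hle : ∫ t in Ioo a b, deriv F t ≤ F b - F a := by
      have := MonotoneOn.intervalIntegral_deriv_mem_uIcc (a := a) (b := b) (f := F)
        (by rwa [uIcc_of_le hab])
      rw [uIcc_of_le (sub_nonneg.2 (hF (left_mem_Icc.2 hab) (right_mem_Icc.2 hab) hab)),
        intervalIntegral.integral_of_le hab, integral_Ioc_eq_integral_Ioo] at this
      exact this.2
    refine le_trans ?_ (ENNReal.ofReal_le_ofReal hle)
    rw [ofReal_integral_eq_lintegral_ofReal hFi ?_]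
    · refine lintegral_mono_ae ?_
      filter_upwards [hpt, ae_restrict_mem measurableSet_Ioo] with t ht hmem
      rw [indicator_of_mem hmem]
      refine le_trans (le_of_eq ?_) (ENNReal.ofReal_le_ofReal (hu t ht).2)
      rw [ENNReal.ofReal_mul (by norm_num), ENNReal.ofReal_pow (norm_nonneg _), ofReal_norm]
      congr 1
      rw [ENNReal.ofReal_div_of_pos (by norm_num)]
      simp
    · filter_upwards [hpt] with t ht
      exact le_trans (by positivity) (hu t ht).2

/-! ### Compactness and the value function -/

/-- A curve with an action bound can be extended to earlier times by waiting at its initial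
point. -/
theorem IsAction.comp_max {N : ℕ} {a b : ℝ} {x : ℝ → Space N} {F : ℝ → ℝ} (h : IsAction a b x F)
    (hab : a ≤ b) (a' : ℝ) :
    IsAction a' b (fun t => x (max a t)) (fun t => F (max a t)) := by
  intro s t hs hst ht p c hc
  dsimp only at hc ⊢
  have h0 : 0 ≤ c := (sq_nonneg _).trans (hc s (left_mem_Icc.2 hst))
  have hmax : max a t - max a s ≤ t - s := by
    rcases le_total a s with has | has
    · rw [max_eq_right has, max_eq_right (has.trans hst)]
    · rw [max_eq_left has]
      rcases le_total a t with hat | hat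
      · rw [max_eq_right hat]; linarith
      · rw [max_eq_left hat]; linarith
  have := h (max a s) (max a t) (le_max_left _ _) (max_le_max le_rfl hst) (max_le hab ht) p c
    fun r hr => by
      have har : a ≤ r := (le_max_left _ _).trans hr.1
      rcases le_or_gt r t with hrt | hrt
      · have := hc r ⟨(le_max_right _ _).trans hr.1, hrt⟩
        rwa [max_eq_right har] at this
      · have hra : r = a := by
          rcases le_max_iff.1 hr.2 with h' | h'
          · exact le_antisymm h' har
          · exact absurd h' (not_le.2 hrt)
        have := hc t (right_mem_Icc.2 hst)
        rwa [max_eq_left (hra ▸ hrt.le), ← hra] at this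
  refine this.trans ?_
  have := mul_le_mul_of_nonneg_right (div_le_div_of_nonneg_right hmax (zero_le_two (α := ℝ))) h0
  linarith

theorem isAction_const {N : ℕ} (a b : ℝ) (y : Space N) :
    IsAction a b (fun _ => y) (fun _ => 0) := by
  intro s t _ hst _ p c hc
  have h0 : 0 ≤ c := (sq_nonneg _).trans (hc s (left_mem_Icc.2 hst))
  simp only [sub_self, inner_zero_right, zero_add]
  exact mul_nonneg (by linarith) h0

/-- Compactness of curves of bounded action: along an ultrafilter, curves and actions converge
pointwise, and the limit keeps the estimates that produce a control. -/
theorem exists_limit_of_isAction {ι : Type*} (U : Ultrafilter ι) {N : ℕ} {a b M R : ℝ}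
    {X : ι → ℝ → Space N} {Φ : ι → ℝ → ℝ} (hab : a ≤ b)
    (hX : ∀ᶠ i in (U : Filter ι), IsAction a b (X i) (Φ i))
    (hΦ : ∀ᶠ i in (U : Filter ι), Φ i a = 0 ∧ Φ i b ≤ M)
    (hR : ∀ᶠ i in (U : Filter ι), ‖X i a‖ ≤ R) :
    ∃ (x : ℝ → Space N) (F : ℝ → ℝ),
      (∀ t ∈ Icc a b, Tendsto (fun i => X i t) U (𝓝 (x t)) ∧
        Tendsto (fun i => Φ i t) U (𝓝 (F t))) ∧
      MonotoneOn F (Icc a b) ∧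
      (∀ s t, a ≤ s → s ≤ t → t ≤ b →
        ‖x t - x s‖ ^ 2 ≤ 2 * (N + 1) * (t - s) * (F t - F s)) ∧
      (∀ s t, a ≤ s → s ≤ t → t ≤ b → ∀ p : Space N, inner ℝ p (x t - x s) ≤
        F t - F s + (t - s) / 2 * (‖sqrtE (x s) p‖ ^ 2 +
          2 * N * Real.sqrt (2 * (N + 1) * M) * Real.sqrt (t - s) * ‖p‖ ^ 2)) := by
  have hex : ∀ t ∈ Icc a b, ∃ y : Space N × ℝ, Tendsto (fun i => (X i t, Φ i t)) U (𝓝 y) := by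
    intro t ht
    have hcpt : IsCompact (Metric.closedBall (0 : Space N)
        (R + Real.sqrt (2 * (N + 1) * (b - a) * M)) ×ˢ Icc (0 : ℝ) M) :=
      (isCompact_closedBall _ _).prod isCompact_Icc
    obtain ⟨y, -, hy⟩ := hcpt.ultrafilter_le_nhds (U.map fun i => (X i t, Φ i t)) (by
      rw [Ultrafilter.coe_map]
      refine tendsto_principal.2 ?_
      filter_upwards [hX, hΦ, hR] with i h1 h2 h3
      have m1 := h1.monotoneOn (left_mem_Icc.2 hab) ht ht.1
      have m2 := h1.monotoneOn ht (right_mem_Icc.2 hab) ht.2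
      refine ⟨?_, by rw [← h2.1]; exact m1, m2.trans h2.2⟩
      rw [mem_closedBall_zero_iff]
      have e1 : ‖X i t - X i a‖ ≤ Real.sqrt (2 * (N + 1) * (b - a) * M) := by
        refine Real.le_sqrt_of_sq_le ((h1.norm_sub_sq_le le_rfl ht.1 ht.2).trans ?_)
        have e4 : (0 : ℝ) ≤ 2 * (N + 1) := by positivity
        refine mul_le_mul (mul_le_mul_of_nonneg_left ?_ e4) ?_ ?_ (mul_nonneg e4 ?_)
        · linarith [ht.2]
        · linarith [h2.1, h2.2]
        · linarith
        · linarith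
      calc ‖X i t‖ = ‖X i a + (X i t - X i a)‖ := by congr 1; abel
        _ ≤ _ := (norm_add_le _ _).trans (add_le_add h3 e1))
    exact ⟨y, hy⟩
  choose! y hy using hex
  have hx : ∀ t ∈ Icc a b, Tendsto (fun i => X i t) U (𝓝 (y t).1) := fun t ht =>
    (continuous_fst.tendsto _).comp (hy t ht)
  have hF : ∀ t ∈ Icc a b, Tendsto (fun i => Φ i t) U (𝓝 (y t).2) := fun t ht =>
    (continuous_snd.tendsto _).comp (hy t ht)
  refine ⟨fun t => (y t).1, fun t => (y t).2, fun t ht => ⟨hx t ht, hF t ht⟩, ?_, ?_, ?_⟩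
  · intro s hs t ht hst
    refine le_of_tendsto_of_tendsto (hF s hs) (hF t ht) ?_
    filter_upwards [hX] with i hi
    exact hi.monotoneOn hs ht hst
  · intro s t hs hst ht
    have hs' : s ∈ Icc a b := ⟨hs, hst.trans ht⟩
    have ht' : t ∈ Icc a b := ⟨hs.trans hst, ht⟩
    refine le_of_tendsto_of_tendsto ((((hx t ht').sub (hx s hs')).norm).pow 2)
      (((hF t ht').sub (hF s hs')).const_mul _) ?_
    filter_upwards [hX] with i hi
    exact hi.norm_sub_sq_le hs hst ht
  · intro s t hs hst ht p
    have hs' : s ∈ Icc a b := ⟨hs, hst.trans ht⟩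
    have ht' : t ∈ Icc a b := ⟨hs.trans hst, ht⟩
    have hS : Continuous fun z : Space N => ‖sqrtE z p‖ ^ 2 :=
      ((continuous_sqrtE.clm_apply continuous_const).norm).pow 2
    refine le_of_tendsto_of_tendsto
      (((innerSL ℝ p).continuous.tendsto _).comp ((hx t ht').sub (hx s hs')))
      (((hF t ht').sub (hF s hs')).add
        ((((hS.tendsto _).comp (hx s hs')).add_const _).const_mul ((t - s) / 2))) ?_
    filter_upwards [hX, hΦ] with i hi hi'
    refine (hi.inner_sub_le hs hst ht (M := M) (by linarith [hi'.1, hi'.2]) p).trans (le_of_eq ?_)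
    have hM : 0 ≤ M := by
      rw [← hi'.1]
      exact (hi.monotoneOn (left_mem_Icc.2 hab) (right_mem_Icc.2 hab) hab).trans hi'.2
    have e1 : Real.sqrt (2 * (N + 1) * (t - s) * M) =
        Real.sqrt (2 * (N + 1) * M) * Real.sqrt (t - s) := by
      rw [← Real.sqrt_mul (by positivity)]
      congr 1; ring
    rw [e1]
    simp only [Function.comp_apply]
    ring

section Value

variable {N : ℕ} {T : ℝ} {g : Space N → ℝ}

theorem valueFunction_le_of_isTrajectory (hb : ∃ C : ℝ, ∀ x, |g x| ≤ C) {t₀ A : ℝ} {y₀ : Space N}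
    {α x : ℝ → Space N} (hA : 0 ≤ A) (hα : AEMeasurable α (volume.restrict (Icc 0 T)))
    (hx : IsTrajectory T α y₀ t₀ x)
    (hle : 1 / 2 * ∫⁻ t in Ioo t₀ T, ‖α t‖ₑ ^ 2 ≤ ENNReal.ofReal A) :
    valueFunction T g (y₀, t₀) ≤ A + g (x T) := by
  rw [← EReal.coe_le_coe_iff, coe_valueFunction T g hb, EReal.coe_add]
  have hcost : extendedValue T g (y₀, t₀) ≤ cost T g t₀ α x :=
    iInf_le_of_le α (iInf_le_of_le x (iInf_le_of_le ⟨hα, hx⟩ le_rfl))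
  refine hcost.trans ?_
  refine add_le_add_left ?_ _
  have := EReal.coe_ennreal_le_coe_ennreal_iff.2 hle
  rwa [EReal.coe_ennreal_ofReal, max_eq_left hA] at this

/-- Nearly optimal trajectories; their controls are square integrable because their cost is finite. -/
theorem exists_isTrajectory_lt (hb : ∃ C : ℝ, ∀ x, |g x| ≤ C) {t₀ : ℝ} (ht₀ : t₀ ∈ Icc 0 T)
    (y₀ : Space N) {η : ℝ} (hη : 0 < η) :
    ∃ α x : ℝ → Space N, IsTrajectory T α y₀ t₀ x ∧
      IntervalIntegrable (fun t => 1 / 2 * ‖α t‖ ^ 2) volume t₀ T ∧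
      (∫ t in t₀..T, 1 / 2 * ‖α t‖ ^ 2) + g (x T) < valueFunction T g (y₀, t₀) + η := by
  have hlt : extendedValue T g (y₀, t₀) < ((valueFunction T g (y₀, t₀) + η : ℝ) : EReal) := by
    rw [← coe_valueFunction T g hb, EReal.coe_lt_coe_iff]
    linarith
  simp only [extendedValue, iInf_lt_iff] at hlt
  obtain ⟨α, x, ⟨hα, hx⟩, hlt⟩ := hlt
  have hα' : AEMeasurable α (volume.restrict (Ioo t₀ T)) :=
    hα.mono_set (Ioo_subset_Icc_self.trans (Icc_subset_Icc_left ht₀.1))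
  have hfin : ∫⁻ t in Ioo t₀ T, ‖α t‖ₑ ^ 2 ≠ ∞ := by
    intro htop
    rw [cost, htop] at hlt
    simp at hlt
  have hi := (integrableOn_norm_sq_of_lintegral hα' hfin).const_mul (1 / 2)
  have hi' : IntervalIntegrable (fun t => 1 / 2 * ‖α t‖ ^ 2) volume t₀ T :=
    (intervalIntegrable_iff_integrableOn_Ioo_of_le ht₀.2).2 hi
  refine ⟨α, x, hx, hi', ?_⟩
  have e : (1 / 2 : ℝ≥0∞) * ∫⁻ t in Ioo t₀ T, ‖α t‖ₑ ^ 2 =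
      ENNReal.ofReal (∫ t in t₀..T, 1 / 2 * ‖α t‖ ^ 2) := by
    rw [intervalIntegral.integral_of_le ht₀.2, integral_Ioc_eq_integral_Ioo,
      ofReal_integral_eq_lintegral_ofReal hi (Eventually.of_forall fun t => by positivity),
      ← lintegral_const_mul' _ _ (by simp)]
    refine lintegral_congr fun t => ?_
    rw [ENNReal.ofReal_mul (by norm_num), ENNReal.ofReal_pow (norm_nonneg _), ofReal_norm]
    congr 1
    rw [ENNReal.ofReal_div_of_pos (by norm_num)]
    simp
  rw [cost, e, EReal.coe_ennreal_ofReal, max_eq_left, ← EReal.coe_add,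
    EReal.coe_lt_coe_iff] at hlt
  · exact hlt
  · exact intervalIntegral.integral_nonneg ht₀.2 fun t _ => by positivity

theorem exists_isAction_lt (hb : ∃ C : ℝ, ∀ x, |g x| ≤ C) {t₀ : ℝ} (ht₀ : t₀ ∈ Icc 0 T)
    (y₀ : Space N) {η : ℝ} (hη : 0 < η) :
    ∃ (x : ℝ → Space N) (F : ℝ → ℝ), IsAction t₀ T x F ∧ x t₀ = y₀ ∧
      F T - F t₀ + g (x T) < valueFunction T g (y₀, t₀) + η := by
  obtain ⟨α, x, hx, hi, hlt⟩ := exists_isTrajectory_lt hb ht₀ y₀ hη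
  exact ⟨x, _, hx.isAction hi, hx.initial, by simpa using hlt⟩

theorem IsAction.valueFunction_le (hb : ∃ C : ℝ, ∀ x, |g x| ≤ C) {t₀ : ℝ} (ht₀ : t₀ ≤ T)
    {x : ℝ → Space N} {F : ℝ → ℝ} (h : IsAction t₀ T x F) :
    valueFunction T g (x t₀, t₀) ≤ F T - F t₀ + g (x T) := by
  have hF0 : 0 ≤ F T - F t₀ :=
    sub_nonneg.2 (h.monotoneOn (left_mem_Icc.2 ht₀) (right_mem_Icc.2 ht₀) ht₀)
  obtain ⟨α, hα, hx, hle⟩ := exists_isTrajectory (C := 2 * (N + 1))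
    (K := 2 * N * Real.sqrt (2 * (N + 1) * (F T - F t₀))) ht₀ (by positivity) h.monotoneOn
    (fun s t hs hst ht => h.norm_sub_sq_le hs hst ht) fun s t hs hst ht p => by
      refine (h.inner_sub_le hs.le hst ht le_rfl p).trans (le_of_eq ?_)
      have e1 : Real.sqrt (2 * (N + 1) * (t - s) * (F T - F t₀)) =
          Real.sqrt (2 * (N + 1) * (F T - F t₀)) * Real.sqrt (t - s) := by
        rw [← Real.sqrt_mul (by positivity)]
        congr 1; ring
      rw [e1]
      ring
  exact valueFunction_le_of_isTrajectory hb hF0 hα.restrict hx hle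

theorem valueFunction_le (hb : ∃ C : ℝ, ∀ x, |g x| ≤ C) {t₀ : ℝ} (ht₀ : t₀ ≤ T) (y₀ : Space N) :
    valueFunction T g (y₀, t₀) ≤ g y₀ := by
  simpa using (isAction_const t₀ T y₀).valueFunction_le hb ht₀

theorem le_valueFunction {C : ℝ} (hC : ∀ x, |g x| ≤ C) {t₀ : ℝ} (ht₀ : t₀ ∈ Icc 0 T)
    (y₀ : Space N) : -C ≤ valueFunction T g (y₀, t₀) := by
  refine le_of_forall_pos_le_add fun η hη => ?_
  obtain ⟨x, F, h, -, hlt⟩ := exists_isAction_lt ⟨C, hC⟩ ht₀ y₀ hη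
  have := h.monotoneOn (left_mem_Icc.2 ht₀.2) (right_mem_Icc.2 ht₀.2) ht₀.2
  linarith [(abs_le.1 (hC (x T))).1]

theorem abs_valueFunction_le {C : ℝ} (hC : ∀ x, |g x| ≤ C) {t₀ : ℝ} (ht₀ : t₀ ∈ Icc 0 T)
    (y₀ : Space N) : |valueFunction T g (y₀, t₀)| ≤ C :=
  abs_le.2 ⟨le_valueFunction hC ht₀ y₀,
    (valueFunction_le ⟨C, hC⟩ ht₀.2 y₀).trans (abs_le.1 (hC y₀)).2⟩

theorem valueFunction_terminal (hb : ∃ C : ℝ, ∀ x, |g x| ≤ C) (hT : 0 ≤ T) (y : Space N) :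
    valueFunction T g (y, T) = g y := by
  refine le_antisymm (valueFunction_le hb le_rfl y) (le_of_forall_pos_le_add fun η hη => ?_)
  obtain ⟨x, F, -, hy, hlt⟩ := exists_isAction_lt hb ⟨hT, le_rfl⟩ y hη
  rw [hy] at hlt
  linarith

theorem lowerSemicontinuousOn_valueFunction (hT : 0 ≤ T) (hg : Continuous g)
    (hb : ∃ C : ℝ, ∀ x, |g x| ≤ C) :
    LowerSemicontinuousOn (valueFunction T g) (univ ×ˢ Icc 0 T) := by
  rintro ⟨y₀, t₀⟩ ⟨-, ht₀⟩ c hc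
  by_contra hcon
  obtain ⟨C, hC⟩ := hb
  have hb : ∃ C : ℝ, ∀ x, |g x| ≤ C := ⟨C, hC⟩
  set η := (valueFunction T g (y₀, t₀) - c) / 2 with hη
  have hη0 : 0 < η := by linarith
  have hne : (𝓝[univ ×ˢ Icc 0 T] (y₀, t₀) ⊓
      𝓟 {p : Space N × ℝ | valueFunction T g p ≤ c}).NeBot := by
    rw [← frequently_mem_iff_neBot]
    exact (not_eventually.1 hcon).mono fun p hp => not_lt.1 hp
  let U : Ultrafilter (Space N × ℝ) := Ultrafilter.of (𝓝[univ ×ˢ Icc 0 T] (y₀, t₀) ⊓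
      𝓟 {p : Space N × ℝ | valueFunction T g p ≤ c})
  have hU := Ultrafilter.of_le (𝓝[univ ×ˢ Icc 0 T] (y₀, t₀) ⊓
      𝓟 {p : Space N × ℝ | valueFunction T g p ≤ c})
  have hUc : ∀ᶠ p in (U : Filter (Space N × ℝ)), valueFunction T g p ≤ c :=
    hU (mem_inf_of_right (mem_principal_self _))
  have hUD : ∀ᶠ p in (U : Filter (Space N × ℝ)), p.2 ∈ Icc 0 T := by
    have : ∀ᶠ p in 𝓝[univ ×ˢ Icc 0 T] (y₀, t₀), p ∈ univ ×ˢ Icc (0 : ℝ) T :=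
      self_mem_nhdsWithin
    filter_upwards [hU (mem_inf_of_left this)] with p hp using hp.2
  have hUn : (U : Filter (Space N × ℝ)) ≤ 𝓝 (y₀, t₀) :=
    hU.trans (inf_le_left.trans nhdsWithin_le_nhds)
  choose! x F hxF hx0 hlt using fun (p : Space N × ℝ) (hp : p.2 ∈ Icc 0 T) =>
    exists_isAction_lt hb hp p.1 hη0
  -- extended by waiting, all curves live on `[0, T]`
  let X : Space N × ℝ → ℝ → Space N := fun p t => x p (max p.2 t)
  let Φ : Space N × ℝ → ℝ → ℝ := fun p t => F p (max p.2 t) - F p p.2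
  have hact : ∀ᶠ p in (U : Filter (Space N × ℝ)), IsAction 0 T (X p) (Φ p) := by
    filter_upwards [hUD] with p hp s t hs hst ht q k hk
    have := (hxF p hp).comp_max hp.2 0 s t hs hst ht q k hk
    simpa [Φ, X] using this
  have hcost : ∀ᶠ p in (U : Filter (Space N × ℝ)), Φ p T + g (X p T) < c + η := by
    filter_upwards [hUD, hUc] with p hp hpc
    simp only [Φ, X, max_eq_right hp.2]
    linarith [hlt p hp]
  obtain ⟨z, G, hlim, hmono, h1, h2⟩ := exists_limit_of_isAction U (M := c + η + C)
    (R := ‖y₀‖ + 1) hT hact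
    (by
      filter_upwards [hUD, hcost] with p hp hpc
      exact ⟨by simp [Φ, max_eq_left hp.1], by linarith [(abs_le.1 (hC (X p T))).1]⟩)
    (by
      have h3 : ∀ᶠ p : Space N × ℝ in 𝓝 (y₀, t₀), ‖p.1‖ < ‖y₀‖ + 1 :=
        (continuous_fst.norm.tendsto (y₀, t₀)).eventually_lt_const (by simp)
      filter_upwards [hUD, hUn h3] with p hp hp3
      simp only [X, max_eq_left hp.1, hx0 p hp]
      exact hp3.le)
  -- the starting times converge, so that equicontinuity identifies the initial point
  have hz : z t₀ = y₀ := by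
    have l1 := (hlim t₀ ht₀).1
    have l2 : Tendsto (fun p : Space N × ℝ => p.1) U (𝓝 y₀) :=
      (continuous_fst.tendsto (y₀, t₀)).mono_left hUn
    have l3 : Tendsto (fun p : Space N × ℝ =>
        Real.sqrt (2 * (N + 1) * |t₀ - p.2| * (c + η + C))) U (𝓝 0) := by
      have : Continuous fun p : Space N × ℝ =>
          Real.sqrt (2 * (N + 1) * |t₀ - p.2| * (c + η + C)) := by fun_prop
      have := (this.tendsto (y₀, t₀)).mono_left hUn
      simpa using this
    refine tendsto_nhds_unique l1 ?_
    have l4 : Tendsto (fun p : Space N × ℝ => X p t₀ - p.1) U (𝓝 0) := by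
      refine squeeze_zero_norm' ?_ l3
      filter_upwards [hUD, hact, hcost] with p hp hpa hpc
      refine Real.le_sqrt_of_sq_le ?_
      -- at time `p.2` the curve `X p` is still at `p.1`
      have e0 : X p p.2 = p.1 := by simp [X, hx0 p hp]
      have e1 : Φ p 0 = 0 := by simp [Φ, max_eq_left hp.1]
      have e2 : Φ p T ≤ c + η + C := by linarith [(abs_le.1 (hC (X p T))).1]
      have e3 : ∀ r ∈ Icc 0 T, 0 ≤ Φ p r ∧ Φ p r ≤ c + η + C := fun r hr =>
        ⟨e1 ▸ hpa.monotoneOn ⟨le_rfl, hT⟩ hr hr.1,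
          (hpa.monotoneOn hr ⟨hT, le_rfl⟩ hr.2).trans e2⟩
      have e4 : (0 : ℝ) ≤ 2 * (N + 1) := by positivity
      rcases le_total p.2 t₀ with hle | hle
      · rw [← e0, abs_of_nonneg (sub_nonneg.2 hle)]
        refine (hpa.norm_sub_sq_le hp.1 hle ht₀.2).trans ?_
        refine mul_le_mul_of_nonneg_left ?_ (mul_nonneg e4 (sub_nonneg.2 hle))
        linarith [(e3 _ ht₀).2, (e3 _ hp).1]
      · rw [← e0, norm_sub_rev, abs_of_nonpos (sub_nonpos.2 hle), neg_sub]
        refine (hpa.norm_sub_sq_le ht₀.1 hle hp.2).trans ?_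
        refine mul_le_mul_of_nonneg_left ?_ (mul_nonneg e4 (sub_nonneg.2 hle))
        linarith [(e3 _ ht₀).1, (e3 _ hp).2]
    simpa using l4.add l2
  have hT' : T ∈ Icc 0 T := ⟨hT, le_rfl⟩
  have hle : G T + g (z T) ≤ c + η :=
    le_of_tendsto ((hlim T hT').2.add ((hg.tendsto _).comp (hlim T hT').1))
      (hcost.mono fun p hp => hp.le)
  have hG0 : 0 ≤ G t₀ := by
    refine ge_of_tendsto (hlim t₀ ht₀).2 ?_
    filter_upwards [hUD, hact] with p hp hpa
    have := hpa.monotoneOn ⟨le_rfl, hT⟩ ht₀ ht₀.1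
    rwa [show Φ p 0 = 0 by simp [Φ, max_eq_left hp.1]] at this
  have hsub : Icc t₀ T ⊆ Icc 0 T := Icc_subset_Icc_left ht₀.1
  obtain ⟨α, hα, hx, hen⟩ := exists_isTrajectory (C := 2 * (N + 1)) ht₀.2 (by positivity)
    (hmono.mono hsub) (fun s t hs hst ht => h1 s t (ht₀.1.trans hs) hst ht)
    fun s t hs hst ht p => h2 s t (ht₀.1.trans hs.le) hst ht p
  rw [hz] at hx
  have := valueFunction_le_of_isTrajectory hb
    (sub_nonneg.2 (hmono ht₀ hT' ht₀.2)) hα.restrict hx hen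
  linarith

end Value

/-! ### Dynamic programming and the viscosity inequalities -/

section Viscosity

variable {N : ℕ} {T : ℝ} {g : Space N → ℝ}

/-- The inequality in the dynamic programming principle that compares `v` with an arbitrary initial
piece of curve. -/
theorem IsAction.valueFunction_le_add (hb : ∃ C : ℝ, ∀ x, |g x| ≤ C) {t t₁ : ℝ}
    (htt : t ≤ t₁) (ht₁ : t₁ ∈ Icc 0 T) {x : ℝ → Space N} {F : ℝ → ℝ} (h : IsAction t t₁ x F) :
    valueFunction T g (x t, t) ≤ F t₁ - F t + valueFunction T g (x t₁, t₁) := by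
  refine le_of_forall_pos_le_add fun η hη => ?_
  obtain ⟨z, G, hz, hzt, hlt⟩ := exists_isAction_lt hb ht₁ (x t₁) hη
  have h1 := (h.trans hz hzt.symm).valueFunction_le hb (htt.trans ht₁.2)
  rw [if_pos htt, if_pos htt] at h1
  by_cases hT : T ≤ t₁
  · have hT' : T = t₁ := le_antisymm hT ht₁.2
    rw [if_pos hT, if_pos hT, hT'] at h1
    rw [hT', hzt] at hlt
    rw [← hT'] at hlt h1 ⊢
    linarith
  · rw [if_neg hT, if_neg hT] at h1
    linarith

/-- The time derivative `τ` and the spatial gradient `q` of a `C¹` test function: they are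
continuous, they give its derivative along curves, and the left-hand side of the equation in terms
of them. -/
theorem exists_deriv_gradient {φ : Space N × ℝ → ℝ} (hφ : ContDiffOn ℝ 1 φ (univ ×ˢ Ioo 0 T)) :
    ∃ (τ : Space N × ℝ → ℝ) (q : Space N × ℝ → Space N),
      ContinuousOn τ (univ ×ˢ Ioo 0 T) ∧ ContinuousOn q (univ ×ˢ Ioo 0 T) ∧
      (∀ y, ∀ t ∈ Ioo 0 T, hjb φ y t = τ (y, t) - 1 / 2 * ‖sqrtE y (q (y, t))‖ ^ 2) ∧
      ∀ (x : ℝ → Space N) (x' : Space N), ∀ t ∈ Ioo 0 T, HasDerivAt x x' t →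
        HasDerivAt (fun r => φ (x r, r)) (τ (x t, t) + inner ℝ (q (x t, t)) x') t := by
  have hO : IsOpen ((univ : Set (Space N)) ×ˢ Ioo (0 : ℝ) T) := isOpen_univ.prod isOpen_Ioo
  have hc : ContinuousOn (fderiv ℝ φ) (univ ×ˢ Ioo 0 T) :=
    hφ.continuousOn_fderiv_of_isOpen hO (le_refl 1)
  have hd : ∀ y : Space N, ∀ t ∈ Ioo 0 T, HasFDerivAt φ (fderiv ℝ φ (y, t)) (y, t) :=
    fun y t ht => ((hφ.differentiableOn (by decide)).differentiableAt
      (hO.mem_nhds ⟨mem_univ _, ht⟩)).hasFDerivAt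
  let q : Space N × ℝ → Space N := fun p => (InnerProductSpace.toDual ℝ (Space N)).symm
    ((fderiv ℝ φ p).comp (ContinuousLinearMap.inl ℝ (Space N) ℝ))
  have hq : ∀ p x', inner ℝ (q p) x' = fderiv ℝ φ p (x', 0) := fun p x' => by
    simp [q, InnerProductSpace.toDual_symm_apply]
  refine ⟨fun p => fderiv ℝ φ p (0, 1), q, hc.clm_apply continuousOn_const, ?_, ?_, ?_⟩
  · exact (InnerProductSpace.toDual ℝ (Space N)).symm.continuous.comp_continuousOn
      (hc.clm_comp continuousOn_const)
  · intro y t ht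
    have h1 : HasDerivAt (fun s => φ (y, s)) (fderiv ℝ φ (y, t) (0, 1)) t :=
      (hd y t ht).comp_hasDerivAt t ((hasDerivAt_const t y).prodMk (hasDerivAt_id t))
    have h2 : HasGradientAt (fun z => φ (z, t)) (q (y, t)) y := by
      rw [hasGradientAt_iff_hasFDerivAt]
      simp only [q, LinearIsometryEquiv.apply_symm_apply]
      exact (hd y t ht).comp y ((hasFDerivAt_id y).prodMk (hasFDerivAt_const t y))
    rw [hjb, hamiltonian_eq, h1.deriv, h2.gradient]
    ring
  · intro x x' t ht hx
    have := HasFDerivAt.comp_hasDerivAt (f := fun r => (x r, r)) t (hd (x t) t ht)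
      (hx.prodMk (hasDerivAt_id t))
    have e : ((0 : Space N), (1 : ℝ)) + (x', 0) = (x', 1) := by simp
    rw [hq, ← map_add, e]
    exact this

/-- The value function satisfies the supersolution inequality: otherwise `t ↦ φ(x(t), t)` would
decrease along every trajectory by less than the energy spent, by a uniform amount. -/
theorem hjb_nonpos_of_isLocalMin (hb : ∃ C : ℝ, ∀ x, |g x| ≤ C) {φ : Space N × ℝ → ℝ}
    (hφ : ContDiffOn ℝ 1 φ (univ ×ˢ Ioo 0 T)) {y₀ : Space N} {t₀ : ℝ} (ht₀ : t₀ ∈ Ioo 0 T)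
    (hmin : IsLocalMin (fun p => valueFunction T g p - φ p) (y₀, t₀)) : hjb φ y₀ t₀ ≤ 0 := by
  by_contra! hpos
  obtain ⟨C, hC⟩ := hb
  have hb : ∃ C : ℝ, ∀ x, |g x| ≤ C := ⟨C, hC⟩
  have hC0 : 0 ≤ C := (abs_nonneg _).trans (hC 0)
  obtain ⟨τ, q, hτ, hq, hjb_eq, hchain⟩ := exists_deriv_gradient hφ
  have hO : (univ : Set (Space N)) ×ˢ Ioo (0 : ℝ) T ∈ 𝓝 (y₀, t₀) :=
    (isOpen_univ.prod isOpen_Ioo).mem_nhds ⟨mem_univ _, ht₀⟩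
  set δ := hjb φ y₀ t₀ / 2 with hδ
  have hδ0 : 0 < δ := by linarith
  have hcont : ContinuousAt (fun p : Space N × ℝ => τ p - 1 / 2 * ‖sqrtE p.1 (q p)‖ ^ 2)
      (y₀, t₀) := by
    refine (hτ.continuousAt hO).sub (continuousAt_const.mul (ContinuousAt.pow ?_ 2))
    exact ((continuous_sqrtE.comp continuous_fst).continuousAt.clm_apply
      (hq.continuousAt hO)).norm
  have hnear : ∀ᶠ p : Space N × ℝ in 𝓝 (y₀, t₀), δ < τ p - 1 / 2 * ‖sqrtE p.1 (q p)‖ ^ 2 := by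
    refine hcont.eventually_const_lt ?_
    dsimp only
    rw [← hjb_eq y₀ t₀ ht₀]
    linarith
  obtain ⟨ρ, hρ, hball⟩ := Metric.eventually_nhds_iff.1 (hnear.and (hmin.and hO))
  -- the energy of nearly optimal controls is at most `2 C + 1`, which bounds their displacement
  set A : ℝ := 2 * (N + 1) * (2 * C + 1) with hA
  have hA0 : 0 < A := by positivity
  obtain ⟨h, hh0, hh⟩ : ∃ h : ℝ, 0 < h ∧ (t₀ + h < T ∧ h < ρ ∧ A * h < ρ ^ 2) := by
    have e1 : ∀ᶠ h in 𝓝[>] (0 : ℝ), t₀ + h < T ∧ h < ρ ∧ A * h < ρ ^ 2 := by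
      have l1 : Tendsto (fun h : ℝ => t₀ + h) (𝓝 0) (𝓝 (t₀ + 0)) :=
        Continuous.tendsto (by fun_prop) 0
      have l3 : Tendsto (fun h : ℝ => A * h) (𝓝 0) (𝓝 (A * 0)) :=
        Continuous.tendsto (by fun_prop) 0
      refine nhdsWithin_le_nhds ((l1.eventually_lt_const (by simpa using ht₀.2)).and
        ((eventually_lt_nhds hρ).and (l3.eventually_lt_const (by simp; positivity))))
    obtain ⟨h, h1, h2⟩ := (e1.and self_mem_nhdsWithin).exists
    exact ⟨h, h2, h1⟩
  set η := min 1 (δ * h) with hη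
  have hη0 : 0 < η := lt_min one_pos (mul_pos hδ0 hh0)
  have ht₀' : t₀ ∈ Icc 0 T := Ioo_subset_Icc_self ht₀
  obtain ⟨α, x, hx, hi, hlt⟩ := exists_isTrajectory_lt hb ht₀' y₀ hη0
  have hact := hx.isAction hi
  set F : ℝ → ℝ := fun t => ∫ r in t₀..t, 1 / 2 * ‖α r‖ ^ 2 with hF
  have hFT : F T ≤ 2 * C + 1 := by
    have h1 := valueFunction_le hb ht₀'.2 y₀
    have h2 := (abs_le.1 (hC y₀)).2
    have h3 := (abs_le.1 (hC (x T))).1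
    have h4 : η ≤ 1 := min_le_left _ _
    have h5 : F T + g (x T) < valueFunction T g (y₀, t₀) + η := hlt
    linarith
  have hF0 : F t₀ = 0 := by simp [hF]
  have hclose : ∀ r ∈ Icc t₀ (t₀ + h), dist (x r, r) (y₀, t₀) < ρ := by
    intro r hr
    rw [Prod.dist_eq, max_lt_iff]
    have hrT : r ≤ T := hr.2.trans hh.1.le
    constructor
    · rw [dist_eq_norm, ← hx.initial]
      refine lt_of_pow_lt_pow_left₀ 2 hρ.le ((hact.norm_sub_sq_le le_rfl hr.1 hrT).trans_lt ?_)
      have m1 := hact.monotoneOn ⟨hr.1, hrT⟩ (right_mem_Icc.2 ht₀'.2) hrT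
      have m2 := hact.monotoneOn (left_mem_Icc.2 ht₀'.2) ⟨hr.1, hrT⟩ hr.1
      have e4 : (0 : ℝ) ≤ 2 * (N + 1) := by positivity
      have e5 : r - t₀ ≤ h := by linarith [hr.2]
      calc _ ≤ 2 * (N + 1) * h * (2 * C + 1) := by
            refine mul_le_mul (mul_le_mul_of_nonneg_left e5 e4) ?_ (sub_nonneg.2 m2)
              (by positivity)
            rw [hF0, sub_zero]
            exact m1.trans hFT
        _ = A * h := by rw [hA]; ring
        _ < ρ ^ 2 := hh.2.2
    · rw [Real.dist_eq, abs_of_nonneg (by linarith [hr.1])]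
      linarith [hr.2, hh.2.1]
  have hth : t₀ ≤ t₀ + h := by linarith
  have hsub : uIcc t₀ (t₀ + h) ⊆ uIcc t₀ T := by
    rw [uIcc_of_le hth, uIcc_of_le ht₀'.2]
    exact Icc_subset_Icc_right hh.1.le
  have hac := (absolutelyContinuousOnInterval_comp_contDiffOn hφ ht₀.1 hth hh.1
    (hx.absolutelyContinuous.mono hsub)).neg
  have hi' := hi.mono_set hsub
  have key := sub_le_integral_of_ae_deriv_le (h := fun r => 1 / 2 * ‖α r‖ ^ 2 - δ) hth hac
    (hi'.sub (by simp)) (by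
      have h1 := ae_restrict_of_ae_restrict_of_subset (Ioo_subset_Ioo_right hh.1.le) hx.hasDerivAt
      filter_upwards [h1, ae_restrict_mem measurableSet_Ioo] with r hr hmem
      have hrT : r ∈ Ioo 0 T := ⟨ht₀.1.trans hmem.1, hmem.2.trans hh.1⟩
      have h2 := (hchain x _ r hrT hr).neg
      have h2' : deriv (-fun t => φ (x t, t)) r = _ := h2.deriv
      rw [h2', ← inner_sqrtE]
      have h3 := (hball (hclose r (Ioo_subset_Icc_self hmem))).1
      have h4 := norm_add_sq_real (sqrtE (x r) (q (x r, r))) (α r)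
      have h5 := sq_nonneg ‖sqrtE (x r) (q (x r, r)) + α r‖
      dsimp only at h3
      linarith)
  rw [intervalIntegral.integral_sub hi' (by simp), intervalIntegral.integral_const,
    smul_eq_mul] at key
  simp only [Pi.neg_apply, hx.initial] at key
  have hloc := (hball (hclose (t₀ + h) (right_mem_Icc.2 hth))).2.1
  have hdpp := (hact.mono hth le_rfl).valueFunction_le hb hh.1.le
  have h6 : F T + g (x T) < valueFunction T g (y₀, t₀) + η := hlt
  have h7 : η ≤ δ * h := min_le_right _ _
  have h8 : F (t₀ + h) = ∫ r in t₀..t₀ + h, 1 / 2 * ‖α r‖ ^ 2 := rfl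
  nlinarith

/-- Curves of steepest descent: `ẋ = -E(x) q` has solutions on time intervals of any length,
because `E` is bounded and Lipschitz; `√E` is not Lipschitz. -/
theorem exists_descent_curve (q y : Space N) (t : ℝ) {h : ℝ} (hh : 0 ≤ h) :
    ∃ x : ℝ → Space N, x t = y ∧
      (∀ s ∈ Icc t (t + h), HasDerivWithinAt x (-opE (x s) q) (Icc t (t + h)) s) ∧
      ∀ s ∈ Icc t (t + h), ‖x s - y‖ ≤ N * ‖q‖ * h := by
  have hbound : ∀ z : Space N, ‖opE z q‖ ≤ N * ‖q‖ := by
    intro z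
    have h1 := norm_sqrtE_sq_le z q
    have h2 := norm_sqrtE_sq_le z (sqrtE z q)
    rw [sqrtE_sqrtE] at h2
    refine (pow_le_pow_iff_left₀ (norm_nonneg _) (by positivity) two_ne_zero).1 ?_
    calc _ ≤ (N : ℝ) * (N * ‖q‖ ^ 2) := h2.trans (mul_le_mul_of_nonneg_left h1 (by positivity))
      _ = (N * ‖q‖) ^ 2 := by ring
  have hth : t ≤ t + h := by linarith
  let t' : Icc t (t + h) := ⟨t, left_mem_Icc.2 hth⟩
  have hpl : IsPicardLindelof (fun _ z => -opE z q) t' y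
      (Real.toNNReal (N * ‖q‖ * h)) 0 (Real.toNNReal (N * ‖q‖))
      (Real.toNNReal (N * (N * (2 * ‖q‖)))) := by
    constructor
    · intro s _
      refine LipschitzOnWith.of_dist_le_mul fun z _ w _ => ?_
      rw [dist_neg_neg, dist_eq_norm, dist_eq_norm, Real.coe_toNNReal _ (by positivity)]
      exact (norm_opE_sub_le z w q).trans (le_of_eq (by ring))
    · exact fun z _ => continuousOn_const
    · intro s _ z _
      rw [norm_neg, Real.coe_toNNReal _ (by positivity)]
      exact hbound z
    · rw [Real.coe_toNNReal _ (by positivity), Real.coe_toNNReal _ (by positivity)]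
      simp [t', hh]
  obtain ⟨x, hx0, hx⟩ := hpl.exists_eq_forall_mem_Icc_hasDerivWithinAt₀
  refine ⟨x, hx0, hx, fun s hs => ?_⟩
  have := (convex_Icc t (t + h)).norm_image_sub_le_of_norm_hasDerivWithin_le (f := x)
    (C := N * ‖q‖) hx (fun r _ => by rw [norm_neg]; exact hbound _) (left_mem_Icc.2 hth) hs
  have hx0' : x t = y := hx0
  rw [hx0', Real.norm_eq_abs, abs_of_nonneg (sub_nonneg.2 hs.1)] at this
  refine this.trans (mul_le_mul_of_nonneg_left ?_ (by positivity))
  linarith [hs.2]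

/-- The subsolution inequality, for any majorant `w` of the value function that is at `(y₀, t₀)`
a limit of its values; it covers both a continuous value function and its upper envelope. -/
theorem hjb_nonneg_of_isLocalMax (hb : ∃ C : ℝ, ∀ x, |g x| ≤ C) {φ w : Space N × ℝ → ℝ}
    (hφ : ContDiffOn ℝ 1 φ (univ ×ˢ Ioo 0 T)) {y₀ : Space N} {t₀ : ℝ} (ht₀ : t₀ ∈ Ioo 0 T)
    (hw : ∀ᶠ p in 𝓝 (y₀, t₀), valueFunction T g p ≤ w p)
    (hw' : ∀ ε > 0, ∃ᶠ p in 𝓝 (y₀, t₀), w (y₀, t₀) - ε < valueFunction T g p)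
    (hmax : IsLocalMax (fun p => w p - φ p) (y₀, t₀)) : 0 ≤ hjb φ y₀ t₀ := by
  by_contra! hneg
  obtain ⟨τ, q, hτ, hq, hjb_eq, hchain⟩ := exists_deriv_gradient hφ
  have hO : (univ : Set (Space N)) ×ˢ Ioo (0 : ℝ) T ∈ 𝓝 (y₀, t₀) :=
    (isOpen_univ.prod isOpen_Ioo).mem_nhds ⟨mem_univ _, ht₀⟩
  rw [hjb_eq y₀ t₀ ht₀] at hneg
  set q₀ := q (y₀, t₀) with hq₀
  set δ := -(τ (y₀, t₀) - 1 / 2 * ‖sqrtE y₀ q₀‖ ^ 2) / 3 with hδ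
  have hδ0 : 0 < δ := by linarith
  -- a bound for the power spent along the descent curves near `(y₀, t₀)`
  set K := 1 / 2 * ‖sqrtE y₀ q₀‖ ^ 2 + δ with hK
  have near1 : ∀ᶠ p : Space N × ℝ in 𝓝 (y₀, t₀), 1 / 2 * ‖sqrtE p.1 q₀‖ ^ 2 < K := by
    have : Continuous fun p : Space N × ℝ => 1 / 2 * ‖sqrtE p.1 q₀‖ ^ 2 :=
      continuous_const.mul ((((continuous_sqrtE.comp continuous_fst).clm_apply
        continuous_const).norm).pow 2)
    refine (this.tendsto _).eventually_lt_const ?_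
    dsimp only
    linarith
  have near2 : ∀ᶠ p : Space N × ℝ in 𝓝 (y₀, t₀), τ p - inner ℝ (q p) (opE p.1 q₀) < -K - δ := by
    have : ContinuousAt (fun p : Space N × ℝ => τ p - inner ℝ (q p) (opE p.1 q₀)) (y₀, t₀) :=
      (hτ.continuousAt hO).sub ((hq.continuousAt hO).inner
        ((continuous_opE.comp continuous_fst).clm_apply continuous_const).continuousAt)
    refine this.eventually_lt_const ?_
    dsimp only
    rw [← hq₀, inner_opE]
    linarith
  obtain ⟨ρ, hρ, hball⟩ := Metric.eventually_nhds_iff.1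
    (near1.and (near2.and (hmax.and (hw.and hO))))
  obtain ⟨h, hh0, hh⟩ : ∃ h : ℝ, 0 < h ∧ (h < ρ / 2 ∧ N * ‖q₀‖ * h < ρ / 2) := by
    have l3 : Tendsto (fun h : ℝ => N * ‖q₀‖ * h) (𝓝 0) (𝓝 (N * ‖q₀‖ * 0)) :=
      Continuous.tendsto (by fun_prop) 0
    have e1 : ∀ᶠ h in 𝓝[>] (0 : ℝ), h < ρ / 2 ∧ N * ‖q₀‖ * h < ρ / 2 :=
      nhdsWithin_le_nhds ((eventually_lt_nhds (by positivity)).and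
        (l3.eventually_lt_const (by simp; positivity)))
    obtain ⟨h, h1, h2⟩ := (e1.and self_mem_nhdsWithin).exists
    exact ⟨h, h2, h1⟩
  have hφc : ContinuousAt φ (y₀, t₀) := hφ.continuousOn.continuousAt hO
  have hev : ∀ᶠ p : Space N × ℝ in 𝓝 (y₀, t₀), dist p (y₀, t₀) < ρ / 2 ∧
      φ p < φ (y₀, t₀) + δ * h / 2 :=
    Filter.Eventually.and (Metric.ball_mem_nhds _ (half_pos hρ))
      (hφc.eventually_lt_const (by have := mul_pos hδ0 hh0; linarith))
  obtain ⟨⟨y, t⟩, hvp, hdist, hφp⟩ :=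
    ((hw' (δ * h / 2) (by positivity)).and_eventually hev).exists
  rw [Prod.dist_eq, max_lt_iff] at hdist
  obtain ⟨x, hx0, hxd, hxb⟩ := exists_descent_curve q₀ y t hh0.le
  have hth : t ≤ t + h := by linarith
  have hclose : ∀ r ∈ Icc t (t + h), dist (x r, r) (y₀, t₀) < ρ := by
    intro r hr
    rw [Prod.dist_eq, max_lt_iff]
    constructor
    · have h1 := dist_triangle (x r) y y₀
      have h2 := hxb r hr
      rw [← dist_eq_norm] at h2
      linarith [hdist.1, hh.2]
    · have h1 := dist_triangle r t t₀
      rw [Real.dist_eq r t, abs_of_nonneg (sub_nonneg.2 hr.1)] at h1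
      linarith [hdist.2, hh.1, hr.2]
  have hmemT : ∀ r ∈ Icc t (t + h), r ∈ Ioo 0 T := fun r hr => (hball (hclose r hr)).2.2.2.2.2
  have hxc : ContinuousOn x (Icc t (t + h)) := fun s hs => (hxd s hs).continuousWithinAt
  have hxd' : ∀ s ∈ Ioo t (t + h), HasDerivAt x (-opE (x s) q₀) s := fun s hs =>
    (hxd s (Ioo_subset_Icc_self hs)).hasDerivAt (Icc_mem_nhds hs.1 hs.2)
  have hact : IsAction t (t + h) x (fun s => K * s) := by
    refine isAction_of_hasDerivAt hxc hxd' fun s hs p => ?_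
    have h1 := (hball (hclose s (Ioo_subset_Icc_self hs))).1
    have h2 := norm_add_sq_real (sqrtE (x s) p) (sqrtE (x s) q₀)
    have h3 := sq_nonneg ‖sqrtE (x s) p + sqrtE (x s) q₀‖
    rw [inner_sqrtE, sqrtE_sqrtE] at h2
    rw [inner_neg_right]
    dsimp only at h1
    linarith
  have hanti : AntitoneOn (fun s => φ (x s, s) + (K + δ) * s) (Icc t (t + h)) := by
    have hd : ∀ s ∈ Ioo t (t + h), HasDerivAt (fun s => φ (x s, s) + (K + δ) * s)
        (τ (x s, s) + inner ℝ (q (x s, s)) (-opE (x s) q₀) + (K + δ) * 1) s := fun s hs =>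
      (hchain x _ s (hmemT s (Ioo_subset_Icc_self hs)) (hxd' s hs)).add
        ((hasDerivAt_id s).const_mul _)
    refine antitoneOn_of_deriv_nonpos (convex_Icc _ _) ?_ ?_ ?_
    · refine ContinuousOn.add ?_ (by fun_prop)
      exact hφ.continuousOn.comp (hxc.prodMk continuousOn_id) fun s hs =>
        ⟨mem_univ _, hmemT s hs⟩
    · intro s hs
      rw [interior_Icc] at hs
      exact (hd s hs).differentiableAt.differentiableWithinAt
    · intro s hs
      rw [interior_Icc] at hs
      rw [(hd s hs).deriv, inner_neg_right]
      have h1 := (hball (hclose s (Ioo_subset_Icc_self hs))).2.1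
      dsimp only at h1
      linarith
  have h1 := hanti (left_mem_Icc.2 hth) (right_mem_Icc.2 hth) hth
  have hend := hmemT _ (right_mem_Icc.2 hth)
  have h2 := hact.valueFunction_le_add hb hth (Ioo_subset_Icc_self hend)
  obtain ⟨-, -, h3, h4, -⟩ := hball (hclose _ (right_mem_Icc.2 hth))
  dsimp only at h1 h3 h4
  rw [hx0] at h1 h2
  nlinarith

end Viscosity

/-! ### Semicontinuous envelopes -/

section Envelopes

variable {N : ℕ} {T C : ℝ} {w : Space N × ℝ → ℝ}

theorem isBoundedUnder_le_domain (hw : ∀ p ∈ domain N T, |w p| ≤ C) (p : Space N × ℝ) :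
    (𝓝[domain N T] p).IsBoundedUnder (· ≤ ·) w :=
  isBoundedUnder_of_eventually_le (a := C) <| by
    filter_upwards [self_mem_nhdsWithin] with q hq using (abs_le.1 (hw q hq)).2

theorem isBoundedUnder_ge_domain (hw : ∀ p ∈ domain N T, |w p| ≤ C) (p : Space N × ℝ) :
    (𝓝[domain N T] p).IsBoundedUnder (· ≥ ·) w :=
  isBoundedUnder_of_eventually_ge (a := -C) <| by
    filter_upwards [self_mem_nhdsWithin] with q hq using (abs_le.1 (hw q hq)).1

theorem neBot_nhdsWithin_domain {p : Space N × ℝ} (hp : p ∈ domain N T) :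
    (𝓝[domain N T] p).NeBot :=
  mem_closure_iff_nhdsWithin_neBot.1 (subset_closure hp)

theorem le_upperEnvelope (hw : ∀ p ∈ domain N T, |w p| ≤ C) {p : Space N × ℝ}
    (hp : p ∈ domain N T) : w p ≤ upperEnvelope T w p := by
  by_contra! h
  have := eventually_lt_of_limsup_lt h (isBoundedUnder_le_domain hw p)
  exact lt_irrefl _ (this.self_of_nhdsWithin hp)

theorem lowerEnvelope_le (hw : ∀ p ∈ domain N T, |w p| ≤ C) {p : Space N × ℝ}
    (hp : p ∈ domain N T) : lowerEnvelope T w p ≤ w p := by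
  by_contra! h
  have := eventually_lt_of_lt_liminf h (isBoundedUnder_ge_domain hw p)
  exact lt_irrefl _ (this.self_of_nhdsWithin hp)

theorem upperEnvelope_le (hw : ∀ p ∈ domain N T, |w p| ≤ C) {p : Space N × ℝ}
    (hp : p ∈ domain N T) {c : ℝ} (hc : ∀ᶠ q in 𝓝[domain N T] p, w q ≤ c) :
    upperEnvelope T w p ≤ c := by
  have := neBot_nhdsWithin_domain hp
  exact limsup_le_of_le (isBoundedUnder_ge_domain hw p).isCoboundedUnder_le hc

theorem frequently_lt_of_lt_upperEnvelope (hw : ∀ p ∈ domain N T, |w p| ≤ C) {p : Space N × ℝ}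
    (hp : p ∈ domain N T) {c : ℝ} (hc : c < upperEnvelope T w p) :
    ∃ᶠ q in 𝓝[domain N T] p, c < w q := by
  have := neBot_nhdsWithin_domain hp
  exact frequently_lt_of_lt_limsup (isBoundedUnder_ge_domain hw p).isCoboundedUnder_le hc

theorem abs_upperEnvelope_le (hw : ∀ p ∈ domain N T, |w p| ≤ C) {p : Space N × ℝ}
    (hp : p ∈ domain N T) : |upperEnvelope T w p| ≤ C := by
  refine abs_le.2 ⟨(abs_le.1 (hw p hp)).1.trans (le_upperEnvelope hw hp),
    upperEnvelope_le hw hp ?_⟩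
  filter_upwards [self_mem_nhdsWithin] with q hq using (abs_le.1 (hw q hq)).2

theorem upperSemicontinuousOn_upperEnvelope (hw : ∀ p ∈ domain N T, |w p| ≤ C) :
    UpperSemicontinuousOn (upperEnvelope T w) (domain N T) := by
  intro p hp c hc
  obtain ⟨c', h1, h2⟩ := exists_between hc
  have := eventually_lt_of_limsup_lt h1 (isBoundedUnder_le_domain hw p)
  filter_upwards [eventually_eventually_nhdsWithin.2 this, self_mem_nhdsWithin] with q hq hqD
  exact (upperEnvelope_le hw hqD (hq.mono fun _ h => h.le)).trans_lt h2

theorem lowerEnvelope_eq (hw : ∀ p ∈ domain N T, |w p| ≤ C)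
    (hlsc : LowerSemicontinuousOn w (domain N T)) {p : Space N × ℝ} (hp : p ∈ domain N T) :
    lowerEnvelope T w p = w p := by
  refine le_antisymm (lowerEnvelope_le hw hp) (le_of_forall_lt fun c hc => ?_)
  obtain ⟨c', h1, h2⟩ := exists_between hc
  have := neBot_nhdsWithin_domain hp
  refine h1.trans_le (le_liminf_of_le (isBoundedUnder_le_domain hw p).isCoboundedUnder_ge ?_)
  filter_upwards [hlsc p hp c' h2] with q hq using hq.le

theorem domain_mem_nhds {y : Space N} {t : ℝ} (ht : t ∈ Ioo 0 T) : domain N T ∈ 𝓝 (y, t) :=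
  mem_of_superset ((isOpen_univ.prod isOpen_Ioo).mem_nhds ⟨mem_univ _, ht⟩)
    (prod_mono_right Ioo_subset_Ioc_self)

theorem domain_subset : domain N T ⊆ univ ×ˢ Icc 0 T := prod_mono_right Ioc_subset_Icc_self

variable {g : Space N → ℝ}

/-- Stated for functions agreeing with the value function on `ℝ^N × (0, T]`, so as to apply to the
value function and to its lower envelope. -/
theorem isViscositySupersolution_of_eqOn (hT : 0 < T) (hg : Continuous g)
    (hb : ∃ C : ℝ, ∀ x, |g x| ≤ C) (hw : EqOn w (valueFunction T g) (domain N T)) :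
    IsViscositySupersolution T g w := by
  obtain ⟨C, hC⟩ := hb
  have hb : ∃ C : ℝ, ∀ x, |g x| ≤ C := ⟨C, hC⟩
  refine ⟨⟨C, fun p hp => ?_⟩, ?_, fun y => ?_, fun φ hφ y₀ t₀ ht₀ hmin => ?_⟩
  · rw [hw hp]
    exact abs_valueFunction_le hC (Ioc_subset_Icc_self hp.2) p.1
  · intro p hp c hc
    rw [hw hp] at hc
    filter_upwards [((lowerSemicontinuousOn_valueFunction hT.le hg hb).mono domain_subset) p hp c hc,
      self_mem_nhdsWithin] with q hq hqD
    rwa [hw hqD]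
  · rw [hw ⟨mem_univ _, hT, le_rfl⟩, valueFunction_terminal hb hT.le]
  · refine hjb_nonpos_of_isLocalMin hb hφ ht₀ (hmin.congr ?_)
    filter_upwards [domain_mem_nhds ht₀] with p hp
    rw [hw hp]

theorem isViscositySubsolution_upperEnvelope (hT : 0 < T) (hg : Continuous g)
    (hb : ∃ C : ℝ, ∀ x, |g x| ≤ C) :
    IsViscositySubsolution T g (upperEnvelope T (valueFunction T g)) := by
  obtain ⟨C, hC⟩ := hb
  have hb : ∃ C : ℝ, ∀ x, |g x| ≤ C := ⟨C, hC⟩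
  have hv : ∀ p ∈ domain N T, |valueFunction T g p| ≤ C := fun p hp =>
    abs_valueFunction_le hC (Ioc_subset_Icc_self hp.2) p.1
  refine ⟨⟨C, fun p hp => abs_upperEnvelope_le hv hp⟩, upperSemicontinuousOn_upperEnvelope hv,
    fun y => ?_, fun φ hφ y₀ t₀ ht₀ hmax => ?_⟩
  · refine le_of_forall_pos_le_add fun ε hε => upperEnvelope_le hv ⟨mem_univ _, hT, le_rfl⟩ ?_
    have h1 : ∀ᶠ q : Space N × ℝ in 𝓝 (y, T), g q.1 < g y + ε :=
      ((hg.comp continuous_fst).tendsto (y, T)).eventually_lt_const (by simpa using hε)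
    filter_upwards [nhdsWithin_le_nhds h1, self_mem_nhdsWithin] with q hq hqD
    exact (valueFunction_le hb hqD.2.2 q.1).trans hq.le
  · refine hjb_nonneg_of_isLocalMax hb hφ ht₀ ?_ (fun ε hε => ?_) hmax
    · filter_upwards [domain_mem_nhds ht₀] with p hp using le_upperEnvelope hv hp
    · exact (frequently_lt_of_lt_upperEnvelope hv ⟨mem_univ _, Ioo_subset_Ioc_self ht₀⟩
        (sub_lt_self _ hε)).filter_mono nhdsWithin_le_nhds

end Envelopes

/-! ### The planar case -/

section PlanarCase

theorem hasDerivAt_mul_abs (w : ℝ) : HasDerivAt (fun w : ℝ => w * |w|) (2 * |w|) w := by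
  rcases eq_or_ne w 0 with rfl | hw
  · rw [hasDerivAt_iff_tendsto_slope_zero]
    have h1 : Tendsto (fun t : ℝ => |t|) (𝓝[≠] 0) (𝓝 (2 * |0|)) := by
      have : Tendsto (fun t : ℝ => |t|) (𝓝 0) (𝓝 |0|) := continuous_abs.tendsto 0
      simpa using this.mono_left nhdsWithin_le_nhds
    refine h1.congr' ?_
    filter_upwards [self_mem_nhdsWithin] with t ht
    have ht' : t ≠ 0 := ht
    simp
    field_simp
  · have h1 := (hasDerivAt_id w).mul (hasDerivAt_abs hw)
    refine h1.congr_deriv ?_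
    rcases lt_or_gt_of_ne hw with h | h
    · simp [h, abs_of_neg]; ring
    · simp [h, abs_of_pos]; ring

theorem hasDerivAt_const_add_sub_mul (c m a t : ℝ) :
    HasDerivAt (fun t => c + (t - a) * m) m t := by
  have := (((hasDerivAt_id t).sub_const a).mul_const m).const_add c
  rwa [one_mul] at this

/-- The signed square root, inverse to `w ↦ w |w|`; the junk value `√d = 0` for `d < 0` of the real
square root makes one of the terms vanish. -/
noncomputable def signedSqrt (d : ℝ) : ℝ := Real.sqrt d - Real.sqrt (-d)

theorem continuous_signedSqrt : Continuous signedSqrt := by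
  unfold signedSqrt; fun_prop

theorem signedSqrt_mul_abs (d : ℝ) : signedSqrt d * |signedSqrt d| = d := by
  unfold signedSqrt
  rcases le_total 0 d with h | h
  · rw [Real.sqrt_eq_zero_of_nonpos (by linarith : -d ≤ 0), sub_zero,
      abs_of_nonneg (Real.sqrt_nonneg _), Real.mul_self_sqrt h]
  · rw [Real.sqrt_eq_zero_of_nonpos h, zero_sub, abs_neg, abs_of_nonneg (Real.sqrt_nonneg _),
      neg_mul, Real.mul_self_sqrt (by linarith), neg_neg]

theorem norm_sqrtE_sq_two (x p : Space 2) : ‖sqrtE x p‖ ^ 2 =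
    1 / 2 * (1 + Real.exp (-|x 0 - x 1|)) * (p 0 + p 1) ^ 2 +
      1 / 2 * (1 - Real.exp (-|x 0 - x 1|)) * (p 0 - p 1) ^ 2 := by
  rw [norm_sqrtE_sq]
  simp only [Fin.sum_univ_two, sub_self, abs_zero, neg_zero, Real.exp_zero, abs_sub_comm (x 1)]
  ring

/-- The Young inequality behind the cost of moving in the plane: `P`, `M` are the components of the
momentum along the eigenvectors `(1, 1)`, `(1, -1)` of `E`, and the eigenvalue `1 - e^{-w²}` is
bounded below by `w² / (1 + w²)`. -/
theorem planar_young {P M s w w' B : ℝ} (hB : w ^ 2 ≤ B) :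
    P / 2 * s + M / 2 * (2 * |w| * w') ≤ s ^ 2 / 4 + w' ^ 2 * (1 + B) +
      1 / 2 * (1 / 2 * (1 + Real.exp (-w ^ 2)) * P ^ 2 +
        1 / 2 * (1 - Real.exp (-w ^ 2)) * M ^ 2) := by
  have he := Real.exp_pos (-w ^ 2)
  have h1 : w ^ 2 / (1 + w ^ 2) ≤ 1 - Real.exp (-w ^ 2) := by
    have h2 : Real.exp (-w ^ 2) * (1 + w ^ 2) ≤ 1 := by
      calc _ ≤ Real.exp (-w ^ 2) * Real.exp (w ^ 2) :=
            mul_le_mul_of_nonneg_left (by linarith [Real.add_one_le_exp (w ^ 2)]) he.le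
        _ = 1 := by rw [← Real.exp_add]; simp
    rw [div_le_iff₀ (by positivity)]
    nlinarith
  have h3 : M * (|w| * w') ≤ 1 / 4 * (w ^ 2 / (1 + w ^ 2)) * M ^ 2 + w' ^ 2 * (1 + w ^ 2) := by
    have hpos : 0 < 1 + w ^ 2 := by positivity
    have h4 : 0 ≤ (1 / 2 * |w| * M - w' * (1 + w ^ 2)) ^ 2 / (1 + w ^ 2) := by positivity
    have h5 : (1 / 2 * |w| * M - w' * (1 + w ^ 2)) ^ 2 / (1 + w ^ 2) =
        1 / 4 * (w ^ 2 / (1 + w ^ 2)) * M ^ 2 + w' ^ 2 * (1 + w ^ 2) - M * (|w| * w') := by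
      rw [← sq_abs w]
      have : 0 < 1 + |w| ^ 2 := by positivity
      field_simp
      ring
    linarith
  have h6 : P / 2 * s ≤ s ^ 2 / 4 + 1 / 4 * (1 + Real.exp (-w ^ 2)) * P ^ 2 := by
    nlinarith [sq_nonneg (P - s), mul_nonneg he.le (sq_nonneg P)]
  have h7 := mul_le_mul_of_nonneg_right h1 (sq_nonneg M)
  have h8 := mul_le_mul_of_nonneg_left hB (sq_nonneg w')
  nlinarith

/-- In the plane nearby points are joined in a given time at small cost. The sum of the coordinates
moves with constant speed, their difference is `w |w|` with `w` affine: this passes at finite cost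
through the diagonal, where `E` degenerates. -/
theorem exists_isAction_joining (y₀ : Space 2) {τ ε : ℝ} (hτ : 0 < τ) (hε : 0 < ε) :
    ∀ᶠ y in 𝓝 y₀, ∀ a : ℝ, ∃ (x : ℝ → Space 2) (K : ℝ),
      IsAction a (a + τ) x (fun t => K * t) ∧ x a = y ∧ x (a + τ) = y₀ ∧ K * τ < ε := by
  let W : Space 2 → ℝ := fun y => signedSqrt (y 0 - y 1)
  have hW : Continuous W := continuous_signedSqrt.comp (by fun_prop)
  let k : Space 2 → ℝ := fun y =>
    (((y₀ 0 + y₀ 1) - (y 0 + y 1)) / τ) ^ 2 / 4 +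
      ((W y₀ - W y) / τ) ^ 2 * (1 + (|W y| + |W y₀|) ^ 2)
  have hk : Continuous k := by
    simp only [k]
    fun_prop
  have hk0 : ∀ᶠ y in 𝓝 y₀, k y * τ < ε :=
    ((hk.mul_const τ).tendsto y₀).eventually_lt_const (by simpa [k] using hε)
  filter_upwards [hk0] with y hy a
  let σ : ℝ → ℝ := fun t => (y 0 + y 1) + (t - a) * (((y₀ 0 + y₀ 1) - (y 0 + y 1)) / τ)
  let ω : ℝ → ℝ := fun t => W y + (t - a) * ((W y₀ - W y) / τ)
  let x : ℝ → Space 2 := fun t => (σ t / 2) • !₂[1, 1] + (ω t * |ω t| / 2) • !₂[1, -1]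
  have hσ : ∀ t, HasDerivAt σ (((y₀ 0 + y₀ 1) - (y 0 + y 1)) / τ) t :=
    hasDerivAt_const_add_sub_mul _ _ a
  have hω : ∀ t, HasDerivAt ω ((W y₀ - W y) / τ) t :=
    hasDerivAt_const_add_sub_mul _ _ a
  have hx : ∀ t, HasDerivAt x ((((y₀ 0 + y₀ 1) - (y 0 + y 1)) / τ / 2) • !₂[1, 1] +
      (2 * |ω t| * ((W y₀ - W y) / τ) / 2) • !₂[1, -1]) t := fun t =>
    (((hσ t).div_const 2).smul_const _).add
      ((((hasDerivAt_mul_abs (ω t)).comp t (hω t)).div_const 2).smul_const _)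
  have hx0 : ∀ t, x t 0 = (σ t + ω t * |ω t|) / 2 := fun t => by simp [x]; ring
  have hx1 : ∀ t, x t 1 = (σ t - ω t * |ω t|) / 2 := fun t => by simp [x]; ring
  refine ⟨x, k y, isAction_of_hasDerivAt (x' := fun t =>
    (((y₀ 0 + y₀ 1) - (y 0 + y 1)) / τ / 2) • !₂[1, 1] +
      (2 * |ω t| * ((W y₀ - W y) / τ) / 2) • !₂[1, -1])
    (fun t _ => (hx t).continuousAt.continuousWithinAt) (fun t _ => hx t) ?_, ?_, ?_, hy⟩
  · intro t ht p
    have hωB : ω t ^ 2 ≤ (|W y| + |W y₀|) ^ 2 := by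
      rw [← sq_abs]
      refine pow_le_pow_left₀ (abs_nonneg _) ?_ 2
      have e1 : ω t = (1 - (t - a) / τ) * W y + (t - a) / τ * W y₀ := by
        simp only [ω]; ring
      have e2 : 0 ≤ (t - a) / τ := div_nonneg (by linarith [ht.1]) hτ.le
      have e3 : (t - a) / τ ≤ 1 := (div_le_one hτ).2 (by linarith [ht.2])
      rw [e1]
      refine (abs_add_le _ _).trans (add_le_add ?_ ?_)
      · rw [abs_mul, abs_of_nonneg (by linarith)]
        exact mul_le_of_le_one_left (abs_nonneg _) (by linarith)
      · rw [abs_mul, abs_of_nonneg e2]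
        exact mul_le_of_le_one_left (abs_nonneg _) e3
    have hd : |x t 0 - x t 1| = ω t ^ 2 := by
      rw [hx0, hx1, show (σ t + ω t * |ω t|) / 2 - (σ t - ω t * |ω t|) / 2 = ω t * |ω t| by ring,
        abs_mul, abs_abs, ← sq, sq_abs]
    rw [norm_sqrtE_sq_two, hd]
    refine le_trans (le_of_eq ?_) (planar_young (P := p 0 + p 1) (M := p 0 - p 1)
      (s := ((y₀ 0 + y₀ 1) - (y 0 + y 1)) / τ) (w' := (W y₀ - W y) / τ) hωB)
    simp [PiLp.inner_apply, Fin.sum_univ_two]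
    ring
  · have e1 : ω a = W y := by simp [ω]
    have e2 : σ a = y 0 + y 1 := by simp [σ]
    have e3 : W y * |W y| = y 0 - y 1 := signedSqrt_mul_abs _
    ext i
    fin_cases i
    · change x a 0 = y 0
      rw [hx0, e1, e2, e3]; ring
    · change x a 1 = y 1
      rw [hx1, e1, e2, e3]; ring
  · have e1 : ω (a + τ) = W y₀ := by simp [ω]; field_simp; ring
    have e2 : σ (a + τ) = y₀ 0 + y₀ 1 := by simp [σ]; field_simp; ring
    have e3 : W y₀ * |W y₀| = y₀ 0 - y₀ 1 := signedSqrt_mul_abs _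
    ext i
    fin_cases i
    · change x (a + τ) 0 = y₀ 0
      rw [hx0, e1, e2, e3]; ring
    · change x (a + τ) 1 = y₀ 1
      rw [hx1, e1, e2, e3]; ring

/-- Upper semicontinuity in the plane: from a nearby point one waits, moves to `y₀`, and then runs
slightly faster through a nearly optimal curve. -/
theorem upperSemicontinuousOn_valueFunction_two {T : ℝ} {g : Space 2 → ℝ} (hT : 0 ≤ T)
    (hg : Continuous g) (hb : ∃ C : ℝ, ∀ x, |g x| ≤ C) :
    UpperSemicontinuousOn (valueFunction T g) (univ ×ˢ Icc 0 T) := by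
  rintro ⟨y₀, t₀⟩ ⟨-, ht₀⟩ c hc
  dsimp only at ht₀
  rcases ht₀.2.eq_or_lt with rfl | hlt
  · rw [valueFunction_terminal hb hT] at hc
    have h1 : ∀ᶠ q : Space 2 × ℝ in 𝓝 (y₀, t₀), g q.1 < c :=
      ((hg.comp continuous_fst).tendsto (y₀, t₀)).eventually_lt_const hc
    filter_upwards [nhdsWithin_le_nhds h1, self_mem_nhdsWithin] with q hq hqD
    exact (valueFunction_le hb hqD.2.2 q.1).trans_lt hq
  · obtain ⟨x, F, hact, hx0, hcost⟩ := exists_isAction_lt hb ht₀ y₀ (sub_pos.2 hc)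
    have h1 : ∀ᶠ t in 𝓝[>] t₀, t < T ∧
        (T - t₀) / (T - t) * (F T - F t₀) + g (x T) < c := by
      have hne : T - t₀ ≠ 0 := (sub_pos.2 hlt).ne'
      have hcont : ContinuousAt (fun t => (T - t₀) / (T - t) * (F T - F t₀) + g (x T)) t₀ := by
        have : ContinuousAt (fun t => (T - t₀) / (T - t)) t₀ :=
          continuousAt_const.div (by fun_prop) hne
        exact (this.mul continuousAt_const).add continuousAt_const
      refine nhdsWithin_le_nhds ((eventually_lt_nhds hlt).and (hcont.eventually_lt_const ?_))
      dsimp only at hcost ⊢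
      rw [div_self hne]
      linarith
    obtain ⟨t₂, ⟨ht₂T, ht₂c⟩, ht₂ : t₀ < t₂⟩ := (h1.and self_mem_nhdsWithin).exists
    -- running through the nearly optimal curve in time `T - t₂`
    have hv2 : valueFunction T g (y₀, t₂) < c := by
      set l := (T - t₀) / (T - t₂) with hl
      have hpos : 0 < T - t₂ := sub_pos.2 ht₂T
      have hl0 : 0 < l := div_pos (sub_pos.2 hlt) hpos
      have hlT : t₀ + l * (T - t₂) = T := by rw [hl]; field_simp; ring
      have := (hact.comp_affine (a' := t₂) (b' := T) hl0 hlT.le).valueFunction_le hb ht₂T.le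
      simp only [sub_self, mul_zero, add_zero, hlT, hx0] at this
      linarith
    set t₁ := (t₀ + t₂) / 2 with ht₁
    have hjoin := exists_isAction_joining y₀ (τ := t₂ - t₁)
      (ε := c - valueFunction T g (y₀, t₂)) (by linarith) (by linarith)
    have h2 : ∀ᶠ q : Space 2 × ℝ in 𝓝 (y₀, t₀), q.2 < t₁ :=
      (continuous_snd.tendsto (y₀, t₀)).eventually_lt_const (by dsimp only; linarith)
    filter_upwards [nhdsWithin_le_nhds ((continuous_fst.tendsto (y₀, t₀)).eventually hjoin),
      nhdsWithin_le_nhds h2, self_mem_nhdsWithin] with q hq hq2 hqD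
    obtain ⟨z, K, hz, hz1, hz2, hK⟩ := hq t₁
    rw [add_sub_cancel] at hz hz2
    have hmem1 : t₁ ∈ Icc 0 T := ⟨by linarith [ht₀.1], by linarith⟩
    have hmem2 : t₂ ∈ Icc 0 T := ⟨by linarith [ht₀.1], ht₂T.le⟩
    have e1 := (isAction_const q.2 t₁ q.1).valueFunction_le_add hb hq2.le hmem1
    have e2 := hz.valueFunction_le_add hb (by linarith) hmem2
    rw [hz1, hz2] at e2
    have e3 : valueFunction T g q = valueFunction T g (q.1, q.2) := rfl
    rw [e3]
    linarith

end PlanarCase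

end Peakon

theorem mainTheorem1 (N : ℕ) (T : ℝ) (hT : 0 < T) (g : Peakon.Space N → ℝ)
    (hg : Continuous g) (hb : ∃ C : ℝ, ∀ x, |g x| ≤ C) :
    (N = 2 →
      ContinuousOn (Peakon.valueFunction T g) (univ ×ˢ Icc 0 T) ∧
      Peakon.IsViscositySolution T g (Peakon.valueFunction T g)) ∧
    (3 ≤ N →
      LowerSemicontinuousOn (Peakon.valueFunction T g) (univ ×ˢ Icc 0 T) ∧
      Peakon.IsDiscontinuousViscositySolution T g (Peakon.valueFunction T g)) := by
  have hlsc := Peakon.lowerSemicontinuousOn_valueFunction hT.le hg hb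
  have hsuper := Peakon.isViscositySupersolution_of_eqOn hT hg hb (eqOn_refl _ _)
  refine ⟨?_, fun _ => ⟨hlsc, hsuper.bounded, Peakon.isViscositySubsolution_upperEnvelope hT hg hb, ?_⟩⟩
  · rintro rfl
    have husc := Peakon.upperSemicontinuousOn_valueFunction_two hT.le hg hb
    refine ⟨continuousOn_iff_lower_upperSemicontinuousOn.2 ⟨hlsc, husc⟩,
      ⟨hsuper.bounded, husc.mono Peakon.domain_subset,
        fun y => (Peakon.valueFunction_terminal hb hT.le y).le, fun φ hφ y₀ t₀ ht₀ hmax => ?_⟩, hsuper⟩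
    exact Peakon.hjb_nonneg_of_isLocalMax hb hφ ht₀ (Eventually.of_forall fun _ => le_rfl)
      (fun ε hε => Frequently.filter_mono (frequently_pure.2 (sub_lt_self _ hε)) (pure_le_nhds _))
      hmax
  · obtain ⟨C, hC⟩ := hsuper.bounded
    exact Peakon.isViscositySupersolution_of_eqOn hT hg hb fun p hp =>
      Peakon.lowerEnvelope_eq hC (hlsc.mono Peakon.domain_subset) hp
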